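/- Units are chosen so that the speed of light and the particle mass are $1$. For $\zeta>0$ let $K_n(\zeta)=\int_0^\infty\cosh(n\vartheta)e^{-\zeta\cosh\vartheta}\,d\vartheta$ and, for $\ell=0,1$, let $\{P^{(\ell)}_n(\cdot\,;\zeta)\}_{n\ge 0}$ be the orthonormal polynomials with positive leading coefficients $c^{(\ell)}_n$ for the weight $\omega^{(\ell)}(x;\zeta)=\frac{(x^2-1)^{\ell-1/2}}{K_1(\zeta)}e^{-\zeta x}$ on $[1,\infty)$. For $|u|<1$ and $\theta>0$ put $\zeta=1/\theta$, $U^0=(1-u^2)^{-1/2}$, $U^1=uU^0$, $p^0=\sqrt{1+p^2}$, $E=U^0p^0-U^1p$, $p_{<1>}=-(p-EU^1)$, $g_{[u,\theta]}(p)=\frac{1}{2K_1(\zeta)}e^{-E/\theta}$, $\langle f,h\rangle=\int_{\mathbb R}\frac{1}{g_{[u,\theta]}}fh\,\frac{dp}{p^0}$, $\tilde P^{(0)}_n=g_{[u,\theta]}P^{(0)}_n(E;\zeta)$, $\tilde P^{(1)}_n=g_{[u,\theta]}(U^0)^{-1}P^{(1)}_n(E;\zeta)\,p_{<1>}$. Let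 $M\ge 1$, and let $\mathcal P_M[u,\theta]=(\tilde P^{(0)}_0,\tilde P^{(0)}_1,\tilde P^{(1)}_0,\dots,\tilde P^{(0)}_M,\tilde P^{(1)}_{M-1})^T$, an orthonormal system of $2M+1$ functions of $p$; let $\Pi_M[u,\theta]$ be the orthogonal projection onto its span. The unknown is $W=(\rho,u,\theta,\Pi,\tilde n^1,f^0_3,f^1_2,\dots,f^0_M,f^1_{M-1})^T\in\mathbb R^{2M+1}$ (only $(\rho,u,\theta)$ if $M=1$). The projected distribution function is $f_W=[\mathcal P_M[u,\theta],D^W_MW]$, where $[\cdot,\cdot]$ is the dot product and $D^W_M=D^W_M(\theta)$ expresses the expansion coefficients $(f^0_0,f^0_1,f^1_0,f^0_2,f^1_1,f^0_3,f^1_2,\dots)$ by $$f^0_0=\frac{\rho}{c^{(0)}_0}-\Pi\,P^{(0)}_0(0;\zeta),\quad f^0_i=-\Pi\,P^{(0)}_i(0;\zeta)\ (i=1,2),\quad f^1_j=-\tilde n^1P^{(1)}_j(0;\zeta)\ (j=0,1),$$ with $\Pi=\tilde n^1=0$ if $M=1$, and by the identity on the remaining components. Let $\tilde D^W_M$ be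 $D^W_M$ with its upper left entry replaced by $0$. Define the matrices $D_M(W)$, $M^t_M$, $M^x_M$ by $$(D_M)_{ij}=\Big\langle\frac{\partial f_W}{\partial W_j},(\mathcal P_M)_i\Big\rangle,\quad (M^t_M)_{ij}=\langle p^0(\mathcal P_M)_j,(\mathcal P_M)_i\rangle,\quad (M^x_M)_{ij}=\langle p\,(\mathcal P_M)_j,(\mathcal P_M)_i\rangle ,$$ and, with a relaxation time $\tau=\tau(\rho,\theta)$, $$B^0=M^t_MD_M,\qquad B^1=M^x_MD_M,\qquad Q_M=-\frac1\tau\big(U^0M^t_M-U^1M^x_M\big)\tilde D^W_M .$$ The moment system with the Anderson–Witting source term is $B^0(W)\partial_tW+B^1(W)\partial_xW=Q_M(W)W$, that is, $\Pi_M\big(p^0\,\Pi_M\partial_t f_W\big)+\Pi_M\big(p\,\Pi_M\partial_x f_W\big)=-\frac1\tau\Pi_M\big(E(f_W-\rho g_{[u,\theta]})\big)$. **Theorem.** The moment system is linearly stable at local equilibrium, both in time and in space. Precisely, let $M\ge1$, $\rho_0>0$, $|u_0|<1$, $\theta_0>0$, $\tau(\rho_0,\theta_0)>0$, and let $B^0,B^1,Q_M$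 be evaluated at $W^{(0)}=(\rho_0,u_0,\theta_0,0,\dots,0)^T$. Plane waves $\tilde W\exp(i(\omega t-kx))$, $\tilde W\neq0$, of the linearized system $B^0\partial_t\bar W+B^1\partial_x\bar W=Q_M\bar W$ satisfy the dispersion relation $$\det\big(i\omega B^0-ikB^1-Q_M\big)=0 .$$ (i) If $k\in\mathbb R$ and $\omega\in\mathbb C$ satisfy it, then $\operatorname{Im}\omega\ge0$. (ii) If $\omega>0$ is real and $k\in\mathbb C$ satisfies it, then $\operatorname{Re}k\cdot\operatorname{Im}k\le0$. -/

import Mathlib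

open scoped Polynomial

noncomputable section

namespace RelMoment

/- Units: speed of light and particle mass are one; `ζ = 1 / θ`. -/

/-- Modified Bessel function of the second kind `K_n`. -/
def besselK (n : ℕ) (ζ : ℝ) : ℝ :=
  ∫ ϑ in Set.Ioi (0 : ℝ), Real.cosh (n * ϑ) * Real.exp (-ζ * Real.cosh ϑ)

/-- The weight functions (`ℓ = 0, 1`) on `[1, ∞)`. -/
def weight (ℓ : ℕ) (ζ x : ℝ) : ℝ :=
  (x ^ 2 - 1) ^ ((ℓ : ℝ) - 1 / 2) / besselK 1 ζ * Real.exp (-ζ * x)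

/-- The inner product of two polynomials with respect to `weight ℓ ζ`. -/
def polyInner (ℓ : ℕ) (ζ : ℝ) (f g : ℝ[X]) : ℝ :=
  ∫ x in Set.Ioi (1 : ℝ), f.eval x * g.eval x * weight ℓ ζ x

/-- The orthonormal polynomials with positive leading coefficient for `weight ℓ ζ`:
the Gram-Schmidt process applied to `1, x, x², …`. -/
def orthoPoly (ℓ : ℕ) (ζ : ℝ) (n : ℕ) : ℝ[X] :=
  let q : ℝ[X] := Polynomial.X ^ n -
    ∑ k : Fin n, Polynomial.C (polyInner ℓ ζ (Polynomial.X ^ n) (orthoPoly ℓ ζ k)) *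
      orthoPoly ℓ ζ k
  Polynomial.C (1 / √(polyInner ℓ ζ q q)) * q
termination_by n
decreasing_by all_goals exact k.isLt

/-- `U⁰`, the Lorentz factor. -/
def U0 (u : ℝ) : ℝ := 1 / √(1 - u ^ 2)

/-- `U¹`. -/
def U1 (u : ℝ) : ℝ := u / √(1 - u ^ 2)

/-- `p⁰` on the mass shell. -/
def p0 (p : ℝ) : ℝ := √(1 + p ^ 2)

/-- `E = U_α p^α` with the metric `diag(1, -1)`. -/
def energy (u p : ℝ) : ℝ := U0 u * p0 p - U1 u * p

/-- `p_{<1>} = -p^{<1>}`, where `p^{<1>} = p¹ - E U¹`. -/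
def pBracket (u p : ℝ) : ℝ := -(p - energy u p * U1 u)

/-- The weight `g⁽⁰⁾_{[u,θ]}` (the local equilibrium of unit mass density). -/
def gEq (u θ p : ℝ) : ℝ := 1 / (2 * besselK 1 (1 / θ)) * Real.exp (-(energy u p / θ))

/-- The inner product `⟨f, h⟩_{g⁽⁰⁾_{[u,θ]}}`. -/
def gInner (u θ : ℝ) (f h : ℝ → ℝ) : ℝ :=
  ∫ p : ℝ, 1 / gEq u θ p * f p * h p / p0 p

/-- `P̃⁽⁰⁾_n[u,θ] = g⁽⁰⁾ P⁽⁰⁾_n(E)`. -/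
def basis0 (n : ℕ) (u θ p : ℝ) : ℝ :=
  gEq u θ p * (orthoPoly 0 (1 / θ) n).eval (energy u p)

/-- `P̃⁽¹⁾_n[u,θ] = g⁽⁰⁾ (U⁰)⁻¹ P⁽¹⁾_n(E) p_{<1>}`. -/
def basis1 (n : ℕ) (u θ p : ℝ) : ℝ :=
  gEq u θ p * (U0 u)⁻¹ * (orthoPoly 1 (1 / θ) n).eval (energy u p) * pBracket u p

/-- The basis, ordered as
`P̃⁽⁰⁾_0, P̃⁽⁰⁾_1, P̃⁽¹⁾_0, P̃⁽⁰⁾_2, P̃⁽¹⁾_1, …, P̃⁽⁰⁾_M, P̃⁽¹⁾_{M-1}` (positions `0, …, 2M`). -/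
def basisFn (i : ℕ) (u θ p : ℝ) : ℝ :=
  if i = 0 then basis0 0 u θ p
  else if i % 2 = 1 then basis0 ((i + 1) / 2) u θ p
  else basis1 (i / 2 - 1) u θ p

/-- The matrix expressing the expansion coefficients
`(f⁰_0, f⁰_1, f¹_0, f⁰_2, f¹_1, f⁰_3, f¹_2, …)` of the distribution function through
`W = (ρ, u, θ, Π, ñ¹, f⁰_3, f¹_2, …)`.  It comes from
`∫ f dp/p⁰ = ρ (c⁽⁰⁾_0)⁻² - Π`, `∫ E f dp/p⁰ = ρ`, `∫ E² f dp/p⁰ = ε₀(ρ, θ)`,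
`∫ p_{<1>} f dp/p⁰ = -n¹`, `∫ E p_{<1>} f dp/p⁰ = 0` and `ñ¹ = n¹ / U⁰`.
Here `P_n(0) = (-1)ⁿ c_n ∏ x_{i,n}`, the `x_{i,n}` being the zeros of `P_n` and `c_n` its
leading coefficient. -/
def coeffMatrix (M : ℕ) (θ : ℝ) : Matrix (Fin (2 * M + 1)) (Fin (2 * M + 1)) ℝ :=
  Matrix.of fun i j =>
    match (i : ℕ), (j : ℕ) with
    | 0, 0 => ((orthoPoly 0 (1 / θ) 0).leadingCoeff)⁻¹
    | 0, 3 => -(orthoPoly 0 (1 / θ) 0).eval 0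
    | 1, 3 => -(orthoPoly 0 (1 / θ) 1).eval 0
    | 3, 3 => -(orthoPoly 0 (1 / θ) 2).eval 0
    | 2, 4 => -(orthoPoly 1 (1 / θ) 0).eval 0
    | 4, 4 => -(orthoPoly 1 (1 / θ) 1).eval 0
    | a, b => if a = b ∧ 5 ≤ a then 1 else 0

/-- `coeffMatrix` with the upper left entry replaced by zero; `coeffMatrixTilde * W` is the
coefficient vector of `f - f⁽⁰⁾`. -/
def coeffMatrixTilde (M : ℕ) (θ : ℝ) : Matrix (Fin (2 * M + 1)) (Fin (2 * M + 1)) ℝ :=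
  Matrix.of fun i j => if (i : ℕ) = 0 ∧ (j : ℕ) = 0 then 0 else coeffMatrix M θ i j

/-- The projected distribution function `Π_M[u,θ] f` as a function of
`W = (ρ, u, θ, Π, ñ¹, f⁰_3, f¹_2, …)` and `p`. -/
def ansatz (M : ℕ) (W : Fin (2 * M + 1) → ℝ) (p : ℝ) : ℝ :=
  ∑ i : Fin (2 * M + 1), (coeffMatrix M (W 2)).mulVec W i * basisFn i (W 1) (W 2) p

/-- The matrix `D_M(W)`: column `j` holds the basis coefficients of the projection of
`∂/∂W_j` of the ansatz, so that
`Π_M ∂_s (Π_M f) = [𝒫_M, D_M ∂_s W]` for `s = t, x`. -/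
def matD (M : ℕ) (W : Fin (2 * M + 1) → ℝ) : Matrix (Fin (2 * M + 1)) (Fin (2 * M + 1)) ℝ :=
  Matrix.of fun i j =>
    gInner (W 1) (W 2)
      (fun p => deriv (fun s => ansatz M (Function.update W j s) p) (W j))
      (basisFn i (W 1) (W 2))

/-- The matrix `M^t_M` of `Π_M (p⁰ ·)` on the basis. -/
def matMt (M : ℕ) (u θ : ℝ) : Matrix (Fin (2 * M + 1)) (Fin (2 * M + 1)) ℝ :=
  Matrix.of fun i j => gInner u θ (fun p => p0 p * basisFn j u θ p) (basisFn i u θ)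

/-- The matrix `M^x_M` of `Π_M (p ·)` on the basis. -/
def matMx (M : ℕ) (u θ : ℝ) : Matrix (Fin (2 * M + 1)) (Fin (2 * M + 1)) ℝ :=
  Matrix.of fun i j => gInner u θ (fun p => p * basisFn j u θ p) (basisFn i u θ)

/-- `B⁰_M(W) = M^t_M D_M`. -/
def matB0 (M : ℕ) (W : Fin (2 * M + 1) → ℝ) : Matrix (Fin (2 * M + 1)) (Fin (2 * M + 1)) ℝ :=
  matMt M (W 1) (W 2) * matD M W

/-- `B¹_M(W) = M^x_M D_M`. -/
def matB1 (M : ℕ) (W : Fin (2 * M + 1) → ℝ) : Matrix (Fin (2 * M + 1)) (Fin (2 * M + 1)) ℝ :=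
  matMx M (W 1) (W 2) * matD M W

/-- `Q_M(W)` for the Anderson-Witting collision term with relaxation time `τ(ρ, θ)`;
the moment system is `B⁰(W) ∂_t W + B¹(W) ∂_x W = S(W)` with `S(W) = Q_M(W) W`. -/
def matQ (M : ℕ) (τ : ℝ → ℝ → ℝ) (W : Fin (2 * M + 1) → ℝ) :
    Matrix (Fin (2 * M + 1)) (Fin (2 * M + 1)) ℝ :=
  (-(1 / τ (W 0) (W 2))) •
    ((U0 (W 1) • matMt M (W 1) (W 2) - U1 (W 1) • matMx M (W 1) (W 2)) *
      coeffMatrixTilde M (W 2))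

/-- The local equilibrium state `(ρ₀, u₀, θ₀, 0, …, 0)`. -/
def equilibrium (M : ℕ) (ρ₀ u₀ θ₀ : ℝ) : Fin (2 * M + 1) → ℝ := fun i =>
  match (i : ℕ) with
  | 0 => ρ₀
  | 1 => u₀
  | 2 => θ₀
  | _ => 0

/-- The dispersion relation `det (iω B⁰ - ik B¹ - Q_M) = 0` of the linearized system
`B⁰ ∂_t V + B¹ ∂_x V = Q_M V` (coefficients frozen at the state `W`) for plane waves
`V = Ṽ exp (i (ω t - k x))`. -/
def DispersionRelation (M : ℕ) (τ : ℝ → ℝ → ℝ) (W : Fin (2 * M + 1) → ℝ) (ω k : ℂ) : Prop :=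
  ((Complex.I * ω) • (matB0 M W).map Complex.ofReal
    - (Complex.I * k) • (matB1 M W).map Complex.ofReal
    - (matQ M τ W).map Complex.ofReal).det = 0

end RelMoment

end

noncomputable section

namespace RelMoment

open MeasureTheory

/-! The proof is an entropy-type energy estimate. Write `T`, `X`, `A` for the Gram matrices of the
basis weighted by `p⁰`, `p` and `E`. They are real symmetric, and `T` and `A` dominate the identity
because `p⁰ ≥ 1` and `E ≥ 1`. For a null vector `w` of the dispersion matrix put `v = D_M w` and `n
= D̃ w`; then `iω T v - ik X v + τ⁻¹ A n = 0`.

At equilibrium `D_M` splits into `D̃` plus a fluid block, whose columns are the derivatives of `ρ g`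
in `ρ`, `u`, `θ`. These lie in the span of `g`, `gE` and `g p_{<1>}` (`exists_matD_equilibrium`).
The Anderson-Witting source conserves mass, momentum and energy, which here means that `A D̃` has
vanishing first three rows (`gram_mul_coeffMatrixTilde`). Hence `v* A n = n* A n ≥ 0`. Since `D_M`
is injective (`eq_zero_of_mulVec_eq_zero`), `v ≠ 0` and `v* T v > 0`. Pairing the equation with `v`
gives `iωt - ikx + s = 0` with `t > 0`, `s ≥ 0` and `x` real
(`DispersionRelation.exists_energy_identity`); its real and imaginary parts yield both claims.

All integrals are computed in the rapidity `y` of the rest frame, `p = sinh (y + a)`. There `E =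
cosh y` and `dp/p⁰ = dy`, and the basis functions become polynomials in `cosh y`, or such
polynomials times `sinh y`, against a weight independent of `u`. -/

/-! ### Continuous functions of polynomial growth in `cosh` -/

/-- Continuous functions bounded by a multiple of a power of `cosh`. -/
def CoshGrowth (F : ℝ → ℝ) : Prop :=
  Continuous F ∧ ∃ (C : ℝ) (n : ℕ), ∀ y, |F y| ≤ C * Real.cosh y ^ n

namespace CoshGrowth

theorem const (c : ℝ) : CoshGrowth fun _ => c :=
  ⟨continuous_const, |c|, 0, fun y => by simp⟩

theorem cosh : CoshGrowth Real.cosh :=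
  ⟨Real.continuous_cosh, 1, 1, fun y => by simp [abs_of_pos (Real.cosh_pos y)]⟩

theorem sinh : CoshGrowth Real.sinh :=
  ⟨Real.continuous_sinh, 1, 1, fun y => by
    rw [one_mul, pow_one]
    refine abs_le_of_sq_le_sq ?_ (Real.cosh_pos y).le
    rw [Real.cosh_sq]
    linarith⟩

theorem mul {F G : ℝ → ℝ} (hF : CoshGrowth F) (hG : CoshGrowth G) :
    CoshGrowth fun y => F y * G y := by
  obtain ⟨hFc, C, n, hC⟩ := hF
  obtain ⟨hGc, D, m, hD⟩ := hG
  refine ⟨hFc.mul hGc, C * D, n + m, fun y => ?_⟩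
  rw [abs_mul, pow_add]
  calc |F y| * |G y| ≤ (C * Real.cosh y ^ n) * (D * Real.cosh y ^ m) :=
        mul_le_mul (hC y) (hD y) (abs_nonneg _) ((abs_nonneg _).trans (hC y))
    _ = _ := by ring

theorem add {F G : ℝ → ℝ} (hF : CoshGrowth F) (hG : CoshGrowth G) :
    CoshGrowth fun y => F y + G y := by
  obtain ⟨hFc, C, n, hC⟩ := hF
  obtain ⟨hGc, D, m, hD⟩ := hG
  refine ⟨hFc.add hGc, |C| + |D|, n + m, fun y => ?_⟩
  have h1 := Real.one_le_cosh y
  have hn : Real.cosh y ^ n ≤ Real.cosh y ^ (n + m) := pow_le_pow_right₀ h1 (by omega)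
  have hm : Real.cosh y ^ m ≤ Real.cosh y ^ (n + m) := pow_le_pow_right₀ h1 (by omega)
  have hp : ∀ k, 0 ≤ Real.cosh y ^ k := fun k => by positivity
  calc |F y + G y| ≤ |F y| + |G y| := abs_add_le _ _
    _ ≤ |C| * Real.cosh y ^ n + |D| * Real.cosh y ^ m :=
        add_le_add ((hC y).trans (mul_le_mul_of_nonneg_right (le_abs_self C) (hp n)))
          ((hD y).trans (mul_le_mul_of_nonneg_right (le_abs_self D) (hp m)))
    _ ≤ |C| * Real.cosh y ^ (n + m) + |D| * Real.cosh y ^ (n + m) := by gcongr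
    _ = _ := by ring

theorem pow {F : ℝ → ℝ} (hF : CoshGrowth F) (k : ℕ) : CoshGrowth fun y => F y ^ k := by
  induction k with
  | zero => simpa using const 1
  | succ k ih => simpa only [pow_succ] using ih.mul hF

theorem neg {F : ℝ → ℝ} (hF : CoshGrowth F) : CoshGrowth fun y => -F y := by
  simpa using (const (-1)).mul hF

theorem sub {F G : ℝ → ℝ} (hF : CoshGrowth F) (hG : CoshGrowth G) :
    CoshGrowth fun y => F y - G y := by
  simpa only [sub_eq_add_neg] using hF.add hG.neg

theorem sum {ι : Type*} (s : Finset ι) {F : ι → ℝ → ℝ} (hF : ∀ i ∈ s, CoshGrowth (F i)) :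
    CoshGrowth fun y => ∑ i ∈ s, F i y := by
  classical
  induction s using Finset.induction_on with
  | empty => simpa using const 0
  | insert a s ha ih =>
    simp only [Finset.sum_insert ha]
    exact (hF a (Finset.mem_insert_self a s)).add
      (ih fun i hi => hF i (Finset.mem_insert_of_mem hi))

theorem eval (f : ℝ[X]) {F : ℝ → ℝ} (hF : CoshGrowth F) :
    CoshGrowth fun y => f.eval (F y) := by
  induction f using Polynomial.induction_on' with
  | add p q hp hq => simpa only [Polynomial.eval_add] using hp.add hq
  | monomial n a => simpa only [Polynomial.eval_monomial] using (const a).mul (hF.pow n)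

end CoshGrowth

/-- Gives a Gaussian majorant for `exp (-b cosh y)`. -/
theorem sq_div_four_le_cosh (y : ℝ) : y ^ 2 / 4 ≤ Real.cosh y := by
  have h := Real.quadratic_le_exp_of_nonneg (abs_nonneg y)
  have h2 : Real.cosh y = (Real.exp |y| + Real.exp (-|y|)) / 2 := by
    rw [← Real.cosh_abs, Real.cosh_eq]
  have h3 := Real.exp_pos (-|y|)
  rw [sq_abs] at h
  have := abs_nonneg y
  rw [h2]
  linarith

theorem integrable_exp_neg_cosh {b : ℝ} (hb : 0 < b) :
    Integrable fun y : ℝ => Real.exp (-b * Real.cosh y) := by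
  refine (integrable_exp_neg_mul_sq (b := b / 4) (by positivity)).mono'
    (by fun_prop) (Filter.Eventually.of_forall fun y => ?_)
  rw [Real.norm_eq_abs, Real.abs_exp, Real.exp_le_exp]
  nlinarith [sq_div_four_le_cosh y]

/-- Half of the exponential decay absorbs the power of `cosh`, through `tⁿ / n! ≤ eᵗ`; the other
half remains integrable. -/
theorem CoshGrowth.integrable_mul_exp {F : ℝ → ℝ} (hF : CoshGrowth F) {b : ℝ} (hb : 0 < b) :
    Integrable fun y : ℝ => F y * Real.exp (-b * Real.cosh y) := by
  obtain ⟨hFc, C, n, hC⟩ := hF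
  refine ((integrable_exp_neg_cosh (half_pos hb)).const_mul
    (|C| * ((n.factorial : ℝ) / (b / 2) ^ n))).mono'
    (by fun_prop) (Filter.Eventually.of_forall fun y => ?_)
  rw [Real.norm_eq_abs, abs_mul, Real.abs_exp]
  have hc := Real.cosh_pos y
  have h1 := Real.pow_div_factorial_le_exp (b / 2 * Real.cosh y) (by positivity) n
  have h2 : Real.cosh y ^ n ≤ (n.factorial : ℝ) / (b / 2) ^ n * Real.exp (b / 2 * Real.cosh y) := by
    rw [mul_pow, div_le_iff₀ (by positivity)] at h1
    rw [div_mul_eq_mul_div, le_div_iff₀ (by positivity)]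
    linarith
  have h3 : Real.exp (-b * Real.cosh y) =
      Real.exp (-(b / 2) * Real.cosh y) * Real.exp (-(b / 2) * Real.cosh y) := by
    rw [← Real.exp_add]
    ring_nf
  have h4 : Real.exp (b / 2 * Real.cosh y) * Real.exp (-(b / 2) * Real.cosh y) = 1 := by
    rw [← Real.exp_add]
    simp
  calc |F y| * Real.exp (-b * Real.cosh y)
      ≤ |C| * Real.cosh y ^ n * Real.exp (-b * Real.cosh y) := by
        gcongr
        exact (hC y).trans (by gcongr; exact le_abs_self C)
    _ ≤ |C| * ((n.factorial : ℝ) / (b / 2) ^ n * Real.exp (b / 2 * Real.cosh y)) *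
          Real.exp (-b * Real.cosh y) := by gcongr
    _ = |C| * ((n.factorial : ℝ) / (b / 2) ^ n) * Real.exp (-(b / 2) * Real.cosh y) *
          (Real.exp (b / 2 * Real.cosh y) * Real.exp (-(b / 2) * Real.cosh y)) := by
        rw [h3]; ring
    _ = _ := by rw [h4, mul_one]

/-! ### The Bessel function `K₁` -/

theorem besselK_one_eq (ζ : ℝ) :
    2 * besselK 1 ζ = ∫ y : ℝ, Real.cosh y * Real.exp (-ζ * Real.cosh y) := by
  have h := integral_comp_abs (f := fun y => Real.cosh y * Real.exp (-ζ * Real.cosh y))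
  simp only [Real.cosh_abs] at h
  simp only [besselK, Nat.cast_one, one_mul]
  exact h.symm

theorem besselK_one_pos {ζ : ℝ} (hζ : 0 < ζ) : 0 < besselK 1 ζ := by
  have h : 0 < ∫ y : ℝ, Real.cosh y * Real.exp (-ζ * Real.cosh y) :=
    integral_pos_of_integrable_nonneg_nonzero (x := 0) (by fun_prop)
      (CoshGrowth.cosh.integrable_mul_exp hζ)
      (fun y => by have := Real.cosh_pos y; positivity) (by simp)
  rw [← besselK_one_eq] at h
  linarith

/-- Differentiation under the integral sign, dominated uniformly for `z > ζ / 2`. It serves the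
`θ`-derivative of the normalization of `gEq`; the value of the derivative never matters. -/
theorem differentiableAt_besselK_one {ζ : ℝ} (hζ : 0 < ζ) :
    DifferentiableAt ℝ (besselK 1) ζ := by
  have key := hasDerivAt_integral_of_dominated_loc_of_deriv_le (μ := volume)
    (F := fun (z y : ℝ) => Real.cosh y * Real.exp (-z * Real.cosh y))
    (F' := fun (z y : ℝ) => Real.cosh y * (Real.exp (-z * Real.cosh y) * (-1 * Real.cosh y)))
    (bound := fun y => Real.cosh y ^ 2 * Real.exp (-(ζ / 2) * Real.cosh y))
    (x₀ := ζ) (s := Set.Ioi (ζ / 2)) (Ioi_mem_nhds (by linarith))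
    (Filter.Eventually.of_forall fun z => by
      apply Continuous.aestronglyMeasurable; fun_prop)
    (CoshGrowth.cosh.integrable_mul_exp hζ)
    (by apply Continuous.aestronglyMeasurable; fun_prop)
    (Filter.Eventually.of_forall fun y z hz => by
      have hc := Real.cosh_pos y
      have hz' : ζ / 2 < z := hz
      rw [Real.norm_eq_abs, abs_mul, abs_mul, Real.abs_exp, abs_mul, abs_of_pos hc]
      have : Real.exp (-z * Real.cosh y) ≤ Real.exp (-(ζ / 2) * Real.cosh y) := by
        rw [Real.exp_le_exp]
        nlinarith
      calc _ = Real.cosh y ^ 2 * Real.exp (-z * Real.cosh y) := by simp; ring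
        _ ≤ _ := by gcongr)
    ((CoshGrowth.cosh.pow 2).integrable_mul_exp (half_pos hζ))
    (Filter.Eventually.of_forall fun y z _ =>
      ((((hasDerivAt_id z).neg).mul_const (Real.cosh y)).exp).const_mul (Real.cosh y))
  have h2 : besselK 1 = fun z => (1 / 2) *
      ∫ y : ℝ, Real.cosh y * Real.exp (-z * Real.cosh y) := by
    funext z
    rw [← besselK_one_eq]
    ring
  rw [h2]
  exact key.2.differentiableAt.const_mul _

/-! ### Integration against the equilibrium in rapidity -/

/-- The local equilibrium of unit mass density in the rapidity variable. -/
def kern (ζ y : ℝ) : ℝ := 1 / (2 * besselK 1 ζ) * Real.exp (-ζ * Real.cosh y)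

/-- Integration against `kern`. -/
def rapInt (ζ : ℝ) (F : ℝ → ℝ) : ℝ := ∫ y, F y * kern ζ y

theorem kern_pos {ζ : ℝ} (hζ : 0 < ζ) (y : ℝ) : 0 < kern ζ y := by
  have := besselK_one_pos hζ
  unfold kern
  positivity

theorem CoshGrowth.integrable_mul_kern {F : ℝ → ℝ} (hF : CoshGrowth F) {ζ : ℝ} (hζ : 0 < ζ) :
    Integrable fun y => F y * kern ζ y := by
  refine ((hF.integrable_mul_exp hζ).const_mul (1 / (2 * besselK 1 ζ))).congr
    (Filter.Eventually.of_forall fun y => ?_)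
  simp only [kern]
  ring

theorem rapInt_add {ζ : ℝ} (hζ : 0 < ζ) {F G : ℝ → ℝ} (hF : CoshGrowth F) (hG : CoshGrowth G) :
    rapInt ζ (fun y => F y + G y) = rapInt ζ F + rapInt ζ G := by
  simp only [rapInt, add_mul]
  exact integral_add (hF.integrable_mul_kern hζ) (hG.integrable_mul_kern hζ)

theorem rapInt_const_mul (ζ c : ℝ) (F : ℝ → ℝ) :
    rapInt ζ (fun y => c * F y) = c * rapInt ζ F := by
  simp only [rapInt, mul_assoc]
  exact integral_const_mul _ _

theorem rapInt_sum {ζ : ℝ} (hζ : 0 < ζ) {ι : Type*} (s : Finset ι) {F : ι → ℝ → ℝ}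
    (hF : ∀ i ∈ s, CoshGrowth (F i)) :
    rapInt ζ (fun y => ∑ i ∈ s, F i y) = ∑ i ∈ s, rapInt ζ (F i) := by
  simp only [rapInt, Finset.sum_mul]
  exact integral_finsetSum _ fun i hi => (hF i hi).integrable_mul_kern hζ

theorem rapInt_pos {ζ : ℝ} (hζ : 0 < ζ) {F : ℝ → ℝ} (hF : CoshGrowth F) (h0 : ∀ y, 0 ≤ F y)
    {x : ℝ} (hx : F x ≠ 0) : 0 < rapInt ζ F := by
  refine integral_pos_of_integrable_nonneg_nonzero (x := x) ?_ (hF.integrable_mul_kern hζ)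
    (fun y => mul_nonneg (h0 y) (kern_pos hζ y).le) (mul_ne_zero hx (kern_pos hζ x).ne')
  have := hF.1
  unfold kern
  fun_prop

theorem rapInt_mono {ζ : ℝ} (hζ : 0 < ζ) {F G : ℝ → ℝ} (hF : CoshGrowth F) (hG : CoshGrowth G)
    (h : ∀ y, F y ≤ G y) : rapInt ζ F ≤ rapInt ζ G :=
  integral_mono (hF.integrable_mul_kern hζ) (hG.integrable_mul_kern hζ)
    fun y => mul_le_mul_of_nonneg_right (h y) (kern_pos hζ y).le

theorem rapInt_eq_zero_of_odd (ζ : ℝ) {F : ℝ → ℝ} (hF : ∀ y, F (-y) = -F y) :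
    rapInt ζ F = 0 := by
  have h := integral_neg_eq_self (fun y => F y * kern ζ y) volume
  have h2 : ∀ y, F (-y) * kern ζ (-y) = -(F y * kern ζ y) := fun y => by
    simp [hF, kern]
  simp only [h2, integral_neg] at h
  rw [rapInt]
  linarith

/-! ### The polynomial inner products -/

theorem cosh_image_Ioi : Real.cosh '' Set.Ioi 0 = Set.Ioi 1 := by
  ext x
  constructor
  · rintro ⟨y, hy, rfl⟩
    exact Real.one_lt_cosh.2 (ne_of_gt hy)
  · intro hx
    obtain ⟨y, hy, rfl⟩ := Real.cosh_surjOn (Set.mem_Ici.2 (le_of_lt hx))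
    refine ⟨y, Set.mem_Ioi.2 (lt_of_le_of_ne hy ?_), rfl⟩
    rintro rfl
    simp at hx

/-- Substitute `x = cosh y`: the Jacobian `sinh y` turns `(x² - 1)^(ℓ - 1/2)` into `sinh^(2ℓ)`.
Extending from `y > 0` to the line by evenness doubles the integral, which the factor `2` in `kern`
compensates. -/
theorem polyInner_eq_rapInt (ℓ : ℕ) (ζ : ℝ) (f h : ℝ[X]) :
    polyInner ℓ ζ f h =
      rapInt ζ fun y => f.eval (Real.cosh y) * h.eval (Real.cosh y) * Real.sinh y ^ (2 * ℓ) := by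
  have habs := integral_comp_abs (f := fun y =>
    f.eval (Real.cosh y) * h.eval (Real.cosh y) * Real.sinh y ^ (2 * ℓ) * kern ζ y)
  have hev : ∀ y : ℝ, Real.sinh |y| ^ (2 * ℓ) = Real.sinh y ^ (2 * ℓ) := fun y => by
    rw [← Real.abs_sinh, pow_mul, sq_abs, ← pow_mul]
  have hk : ∀ y, kern ζ |y| = kern ζ y := fun y => by simp [kern]
  simp only [Real.cosh_abs, hev, hk] at habs
  rw [polyInner, rapInt, habs, ← cosh_image_Ioi,
    integral_image_eq_integral_abs_deriv_smul measurableSet_Ioi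
      (fun y _ => (Real.hasDerivAt_cosh y).hasDerivWithinAt)
      (Real.cosh_strictMonoOn.injOn.mono Set.Ioi_subset_Ici_self), ← integral_const_mul]
  refine setIntegral_congr_fun measurableSet_Ioi fun y hy => ?_
  have hs : 0 < Real.sinh y := Real.sinh_pos_iff.2 hy
  have hw : Real.sinh y * (Real.cosh y ^ 2 - 1) ^ ((ℓ : ℝ) - 1 / 2) = Real.sinh y ^ (2 * ℓ) := by
    rw [← Real.sinh_sq, ← Real.rpow_natCast _ 2, ← Real.rpow_mul hs.le]
    nth_rewrite 1 [← Real.rpow_one (Real.sinh y)]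
    rw [← Real.rpow_add hs, ← Real.rpow_natCast]
    congr 1
    push_cast
    ring
  simp only [smul_eq_mul, weight, kern, abs_of_pos hs]
  calc _ = f.eval (Real.cosh y) * h.eval (Real.cosh y) *
        (Real.sinh y * (Real.cosh y ^ 2 - 1) ^ ((ℓ : ℝ) - 1 / 2)) / besselK 1 ζ *
          Real.exp (-ζ * Real.cosh y) := by ring
    _ = _ := by
      rw [hw]
      by_cases hK : besselK 1 ζ = 0
      · simp [hK]
      · field_simp

theorem coshGrowth_polyInner (ℓ : ℕ) (f h : ℝ[X]) :
    CoshGrowth fun y => f.eval (Real.cosh y) * h.eval (Real.cosh y) * Real.sinh y ^ (2 * ℓ) :=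
  ((CoshGrowth.cosh.eval f).mul (CoshGrowth.cosh.eval h)).mul (CoshGrowth.sinh.pow _)

theorem polyInner_comm (ℓ : ℕ) (ζ : ℝ) (f h : ℝ[X]) : polyInner ℓ ζ f h = polyInner ℓ ζ h f := by
  simp only [polyInner, mul_comm (f.eval _)]

theorem polyInner_add_left (ℓ : ℕ) {ζ : ℝ} (hζ : 0 < ζ) (f g h : ℝ[X]) :
    polyInner ℓ ζ (f + g) h = polyInner ℓ ζ f h + polyInner ℓ ζ g h := by
  simp only [polyInner_eq_rapInt, Polynomial.eval_add, add_mul]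
  exact rapInt_add hζ (coshGrowth_polyInner ℓ f h) (coshGrowth_polyInner ℓ g h)

theorem polyInner_smul_left (ℓ : ℕ) (ζ c : ℝ) (f h : ℝ[X]) :
    polyInner ℓ ζ (c • f) h = c * polyInner ℓ ζ f h := by
  simp only [polyInner_eq_rapInt, Polynomial.eval_smul, smul_eq_mul, mul_assoc]
  exact rapInt_const_mul _ _ _

/-- `polyInner` as a bilinear form. -/
def polyForm (ℓ : ℕ) {ζ : ℝ} (hζ : 0 < ζ) : LinearMap.BilinForm ℝ ℝ[X] :=
  LinearMap.mk₂ ℝ (polyInner ℓ ζ) (polyInner_add_left ℓ hζ) (polyInner_smul_left ℓ ζ)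
    (fun f g h => by
      rw [polyInner_comm, polyInner_add_left ℓ hζ, polyInner_comm ℓ ζ g, polyInner_comm ℓ ζ h])
    (fun c f h => by
      rw [polyInner_comm, polyInner_smul_left, polyInner_comm ℓ ζ h, smul_eq_mul])

theorem polyForm_apply (ℓ : ℕ) {ζ : ℝ} (hζ : 0 < ζ) (f h : ℝ[X]) :
    polyForm ℓ hζ f h = polyInner ℓ ζ f h := rfl

/-- A nonzero polynomial has finitely many roots, so the nonnegative integrand is nonzero somewhere.
The factor `m` is `1` for definiteness and `X` for `orthoPoly_eval_zero_ne`. -/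
theorem polyInner_mul_self_pos (ℓ : ℕ) {ζ : ℝ} (hζ : 0 < ζ) {m f : ℝ[X]} (hm : m ≠ 0)
    (hm0 : ∀ y, 0 ≤ m.eval (Real.cosh y)) (hf : f ≠ 0) : 0 < polyInner ℓ ζ (m * f) f := by
  have hfin : ((m * f).rootSet ℝ).Finite := Polynomial.rootSet_finite _ _
  obtain ⟨x, hx, hxr⟩ := (Set.Ioi_infinite (1 : ℝ)).exists_notMem_finite hfin
  rw [← cosh_image_Ioi] at hx
  obtain ⟨y, hy, rfl⟩ := hx
  have hs : Real.sinh y ≠ 0 := (Real.sinh_pos_iff.2 hy).ne'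
  have hev : m.eval (Real.cosh y) * f.eval (Real.cosh y) ≠ 0 := by
    intro h0
    exact hxr (Polynomial.mem_rootSet.2 ⟨mul_ne_zero hm hf, by simpa using h0⟩)
  rw [polyInner_eq_rapInt]
  refine rapInt_pos hζ (coshGrowth_polyInner ℓ _ f) (fun z => ?_) (x := y) ?_
  · rw [Polynomial.eval_mul, mul_assoc (m.eval _), pow_mul]
    have := hm0 z
    have := mul_self_nonneg (f.eval (Real.cosh z))
    positivity
  · rw [Polynomial.eval_mul]
    exact mul_ne_zero (mul_ne_zero hev (right_ne_zero_of_mul hev)) (pow_ne_zero _ hs)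

theorem polyInner_self_pos (ℓ : ℕ) {ζ : ℝ} (hζ : 0 < ζ) {f : ℝ[X]} (hf : f ≠ 0) :
    0 < polyInner ℓ ζ f f := by
  simpa using polyInner_mul_self_pos ℓ hζ (one_ne_zero) (by simp) hf

/-! ### Orthonormal polynomials -/

/-- The monic polynomials of the Gram-Schmidt process. -/
def monicPoly (ℓ : ℕ) (ζ : ℝ) (n : ℕ) : ℝ[X] :=
  Polynomial.X ^ n - ∑ k : Fin n,
    Polynomial.C (polyInner ℓ ζ (Polynomial.X ^ n) (orthoPoly ℓ ζ k)) * orthoPoly ℓ ζ k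

theorem orthoPoly_eq (ℓ : ℕ) (ζ : ℝ) (n : ℕ) : orthoPoly ℓ ζ n =
    Polynomial.C (1 / √(polyInner ℓ ζ (monicPoly ℓ ζ n) (monicPoly ℓ ζ n))) *
      monicPoly ℓ ζ n := by
  rw [orthoPoly]
  rfl

/-- The degree bound is a hypothesis so that the strong induction in `natDegree_orthoPoly_le` can
feed its own conclusion back. -/
theorem monicPoly_aux (ℓ : ℕ) (ζ : ℝ) {n : ℕ}
    (h : ∀ k < n, (orthoPoly ℓ ζ k).natDegree ≤ k) :
    (monicPoly ℓ ζ n).Monic ∧ (monicPoly ℓ ζ n).natDegree = n := by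
  have hdeg : (∑ k : Fin n, Polynomial.C (polyInner ℓ ζ (Polynomial.X ^ n) (orthoPoly ℓ ζ k)) *
      orthoPoly ℓ ζ k).degree < n := by
    refine (Polynomial.degree_sum_le _ _).trans_lt ((Finset.sup_lt_iff (WithBot.bot_lt_coe n)).2
      fun k _ => ?_)
    refine (Polynomial.degree_le_of_natDegree_le
      ((Polynomial.natDegree_C_mul_le _ _).trans (h k k.isLt))).trans_lt ?_
    exact Nat.cast_lt.2 k.isLt
  refine ⟨Polynomial.monic_X_pow_sub hdeg, ?_⟩
  refine Polynomial.natDegree_eq_of_degree_eq_some ?_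
  rw [monicPoly, Polynomial.degree_sub_eq_left_of_degree_lt (by rwa [Polynomial.degree_X_pow]),
    Polynomial.degree_X_pow]

theorem natDegree_orthoPoly_le (ℓ : ℕ) (ζ : ℝ) (n : ℕ) : (orthoPoly ℓ ζ n).natDegree ≤ n := by
  induction n using Nat.strong_induction_on with
  | _ n ih =>
    rw [orthoPoly_eq]
    exact (Polynomial.natDegree_C_mul_le _ _).trans (monicPoly_aux ℓ ζ ih).2.le

theorem monicPoly_monic (ℓ : ℕ) (ζ : ℝ) (n : ℕ) : (monicPoly ℓ ζ n).Monic :=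
  (monicPoly_aux ℓ ζ fun k _ => natDegree_orthoPoly_le ℓ ζ k).1

theorem natDegree_monicPoly (ℓ : ℕ) (ζ : ℝ) (n : ℕ) : (monicPoly ℓ ζ n).natDegree = n :=
  (monicPoly_aux ℓ ζ fun k _ => natDegree_orthoPoly_le ℓ ζ k).2

/-- The normalization factor of `orthoPoly` (its leading coefficient). -/
def orthoScale (ℓ : ℕ) (ζ : ℝ) (n : ℕ) : ℝ :=
  1 / √(polyInner ℓ ζ (monicPoly ℓ ζ n) (monicPoly ℓ ζ n))

theorem orthoPoly_eq_smul (ℓ : ℕ) (ζ : ℝ) (n : ℕ) :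
    orthoPoly ℓ ζ n = orthoScale ℓ ζ n • monicPoly ℓ ζ n := by
  rw [orthoPoly_eq, Polynomial.smul_eq_C_mul, orthoScale]

theorem orthoScale_pos (ℓ : ℕ) {ζ : ℝ} (hζ : 0 < ζ) (n : ℕ) : 0 < orthoScale ℓ ζ n := by
  have := polyInner_self_pos ℓ hζ (monicPoly_monic ℓ ζ n).ne_zero
  unfold orthoScale
  positivity

theorem orthoPoly_ne_zero (ℓ : ℕ) {ζ : ℝ} (hζ : 0 < ζ) (n : ℕ) : orthoPoly ℓ ζ n ≠ 0 := by
  rw [orthoPoly_eq_smul]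
  exact smul_ne_zero (orthoScale_pos ℓ hζ n).ne' (monicPoly_monic ℓ ζ n).ne_zero

theorem natDegree_orthoPoly (ℓ : ℕ) {ζ : ℝ} (hζ : 0 < ζ) (n : ℕ) :
    (orthoPoly ℓ ζ n).natDegree = n := by
  rw [orthoPoly_eq_smul, Polynomial.natDegree_smul _ (orthoScale_pos ℓ hζ n).ne',
    natDegree_monicPoly]

theorem orthoPoly_zero (ℓ : ℕ) (ζ : ℝ) :
    orthoPoly ℓ ζ 0 = Polynomial.C (orthoScale ℓ ζ 0) := by
  rw [orthoPoly_eq_smul, Polynomial.smul_eq_C_mul]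
  simp [monicPoly]

theorem polyInner_orthoPoly_self (ℓ : ℕ) {ζ : ℝ} (hζ : 0 < ζ) (n : ℕ) :
    polyInner ℓ ζ (orthoPoly ℓ ζ n) (orthoPoly ℓ ζ n) = 1 := by
  have h := polyInner_self_pos ℓ hζ (monicPoly_monic ℓ ζ n).ne_zero
  rw [orthoPoly_eq_smul, polyInner_smul_left, polyInner_comm, polyInner_smul_left, orthoScale,
    ← mul_assoc, div_mul_div_comm, Real.mul_self_sqrt h.le]
  field_simp

theorem polyInner_orthoPoly_of_lt (ℓ : ℕ) {ζ : ℝ} (hζ : 0 < ζ) {m n : ℕ} (hmn : m < n) :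
    polyInner ℓ ζ (orthoPoly ℓ ζ n) (orthoPoly ℓ ζ m) = 0 := by
  induction n using Nat.strong_induction_on generalizing m with
  | _ n ih =>
    have hzero : ∀ k : Fin n, k ≠ ⟨m, hmn⟩ →
        polyInner ℓ ζ (orthoPoly ℓ ζ k) (orthoPoly ℓ ζ m) = 0 := fun k hk => by
      rcases lt_trichotomy (k : ℕ) m with h | h | h
      · rw [polyInner_comm]
        exact ih m hmn h
      · exact absurd (Fin.ext h) hk
      · exact ih k k.isLt h
    rw [orthoPoly_eq_smul, polyInner_smul_left]
    refine mul_eq_zero_of_right _ ?_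
    simp only [monicPoly, ← polyForm_apply ℓ hζ, ← Polynomial.smul_eq_C_mul, map_sub, map_sum,
      map_smul, LinearMap.sub_apply, LinearMap.sum_apply, LinearMap.smul_apply, smul_eq_mul]
    -- Only the subtracted projection onto the `m`-th polynomial survives, and it cancels the
    -- contribution of `X ^ n`.
    rw [Finset.sum_eq_single ⟨m, hmn⟩ (fun k _ hk => ?_) (fun h => absurd (Finset.mem_univ _) h)]
    · simp only [polyForm_apply, polyInner_orthoPoly_self ℓ hζ]
      ring
    · rw [polyForm_apply ℓ hζ (orthoPoly ℓ ζ k), hzero k hk, mul_zero]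

theorem polyInner_orthoPoly (ℓ : ℕ) {ζ : ℝ} (hζ : 0 < ζ) (m n : ℕ) :
    polyInner ℓ ζ (orthoPoly ℓ ζ m) (orthoPoly ℓ ζ n) = if m = n then 1 else 0 := by
  split_ifs with h
  · rw [h, polyInner_orthoPoly_self ℓ hζ]
  · rcases lt_or_gt_of_ne h with h | h
    · rw [polyInner_comm, polyInner_orthoPoly_of_lt ℓ hζ h]
    · exact polyInner_orthoPoly_of_lt ℓ hζ h

/-- Expansion of a polynomial of degree less than `n` in orthonormal polynomials. -/
theorem eq_sum_orthoPoly (ℓ : ℕ) {ζ : ℝ} (hζ : 0 < ζ) {n : ℕ} {f : ℝ[X]} (hf : f.degree < n) :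
    f = ∑ k ∈ Finset.range n, polyInner ℓ ζ f (orthoPoly ℓ ζ k) • orthoPoly ℓ ζ k := by
  -- Orthonormality determines the coefficients, so any expansion will do; one is found by removing
  -- leading terms.
  suffices h : ∃ c : ℕ → ℝ, f = ∑ k ∈ Finset.range n, c k • orthoPoly ℓ ζ k by
    obtain ⟨c, hc⟩ := h
    have hck : ∀ k ∈ Finset.range n, polyInner ℓ ζ f (orthoPoly ℓ ζ k) = c k := fun k hk => by
      rw [hc, ← polyForm_apply ℓ hζ]
      simp only [map_sum, map_smul, LinearMap.sum_apply, LinearMap.smul_apply, smul_eq_mul,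
        polyForm_apply, polyInner_orthoPoly ℓ hζ]
      rw [Finset.sum_eq_single k (fun j _ hj => by simp [hj]) (fun h => absurd hk h)]
      simp
    conv_lhs => rw [hc]
    exact Finset.sum_congr rfl fun k hk => by rw [hck k hk]
  induction n generalizing f with
  | zero => exact ⟨0, by simpa using hf⟩
  | succ n ih =>
    have hlt : (f - f.coeff n • monicPoly ℓ ζ n).degree < n := by
      rw [Polynomial.degree_lt_iff_coeff_zero] at hf ⊢
      intro m hm
      rcases hm.eq_or_lt with rfl | hm
      · have := (monicPoly_monic ℓ ζ n).coeff_natDegree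
        rw [natDegree_monicPoly] at this
        simp [this]
      · rw [Polynomial.coeff_sub, Polynomial.coeff_smul, hf m hm,
          Polynomial.coeff_eq_zero_of_natDegree_lt (p := monicPoly ℓ ζ n)
            (by rw [natDegree_monicPoly]; exact hm)]
        simp
    obtain ⟨c, hc⟩ := ih hlt
    refine ⟨fun k => if k = n then f.coeff n / orthoScale ℓ ζ n else c k, ?_⟩
    have hs := (orthoScale_pos ℓ hζ n).ne'
    rw [Finset.sum_range_succ, Finset.sum_congr rfl fun k hk =>
      show _ = c k • orthoPoly ℓ ζ k by simp only [if_neg (Finset.mem_range.1 hk).ne], ← hc]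
    simp only [if_true]
    rw [orthoPoly_eq_smul, smul_smul, div_mul_cancel₀ _ hs]
    abel

theorem polyInner_orthoPoly_of_degree_lt (ℓ : ℕ) {ζ : ℝ} (hζ : 0 < ζ) {n : ℕ} {f : ℝ[X]}
    (hf : f.degree < n) : polyInner ℓ ζ f (orthoPoly ℓ ζ n) = 0 := by
  rw [eq_sum_orthoPoly ℓ hζ hf, ← polyForm_apply ℓ hζ]
  simp only [map_sum, map_smul, LinearMap.sum_apply, LinearMap.smul_apply, smul_eq_mul,
    polyForm_apply, polyInner_orthoPoly ℓ hζ]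
  exact Finset.sum_eq_zero fun k hk => by simp [(Finset.mem_range.1 hk).ne]

/-- The reproducing property at `0` of the kernel `∑ Pₖ(x) Pₖ(y)`. -/
theorem sum_polyInner_mul_eval (ℓ : ℕ) {ζ : ℝ} (hζ : 0 < ζ) {n : ℕ} {f : ℝ[X]}
    (hf : f.degree < n) (x : ℝ) :
    ∑ k ∈ Finset.range n, polyInner ℓ ζ f (orthoPoly ℓ ζ k) * (orthoPoly ℓ ζ k).eval x =
      f.eval x := by
  conv_rhs => rw [eq_sum_orthoPoly ℓ hζ hf]
  simp [Polynomial.eval_finsetSum]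

/-- If `P = X q`, then `q` has lower degree and is orthogonal to `P`, yet `⟨X q, q⟩ > 0` because
`cosh > 0`. These values are the diagonal entries of `coeffMatrix` for `Π` and `ñ¹`. -/
theorem orthoPoly_eval_zero_ne (ℓ : ℕ) {ζ : ℝ} (hζ : 0 < ζ) (n : ℕ) :
    (orthoPoly ℓ ζ n).eval 0 ≠ 0 := by
  intro h0
  obtain ⟨q, hq⟩ := Polynomial.X_dvd_iff.2 ((Polynomial.coeff_zero_eq_eval_zero _).trans h0)
  have hP := orthoPoly_ne_zero ℓ hζ n
  have hq0 : q ≠ 0 := fun h => hP (by rw [hq, h, mul_zero])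
  have hdeg : q.degree < n := by
    have h1 := natDegree_orthoPoly ℓ hζ n
    rw [hq, Polynomial.natDegree_X_mul hq0] at h1
    rw [Polynomial.degree_eq_natDegree hq0]
    exact_mod_cast (by omega : q.natDegree < n)
  have h1 := polyInner_orthoPoly_of_degree_lt ℓ hζ hdeg
  rw [polyInner_comm, hq] at h1
  exact (polyInner_mul_self_pos ℓ hζ Polynomial.X_ne_zero
    (fun y => by simpa using (Real.cosh_pos y).le) hq0).ne' h1

/-! ### The rapidity variable -/

theorem one_sub_sq_pos {u : ℝ} (hu : |u| < 1) : 0 < 1 - u ^ 2 := by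
  have := (sq_lt_one_iff_abs_lt_one u).2 hu
  linarith

theorem U0_pos {u : ℝ} (hu : |u| < 1) : 0 < U0 u := by
  have := one_sub_sq_pos hu
  unfold U0
  positivity

theorem exists_rapidity {u : ℝ} (hu : |u| < 1) :
    ∃ a : ℝ, Real.cosh a = U0 u ∧ Real.sinh a = U1 u := by
  have h := one_sub_sq_pos hu
  refine ⟨Real.arsinh (U1 u), ?_, Real.sinh_arsinh _⟩
  rw [Real.cosh_arsinh, U0, Real.sqrt_eq_iff_mul_self_eq_of_pos (by positivity), U1, div_pow,
    Real.sq_sqrt h.le, ← pow_two, div_pow, Real.sq_sqrt h.le]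
  field_simp
  ring

theorem p0_sinh (y : ℝ) : p0 (Real.sinh y) = Real.cosh y := by
  rw [p0, add_comm, ← Real.cosh_sq, Real.sqrt_sq (Real.cosh_pos y).le]

/-- The Lorentz-invariant measure `dp/p⁰` is `dy`, and a boost is a translation in `y`. -/
theorem integral_div_p0 (F : ℝ → ℝ) (a : ℝ) :
    ∫ p, F p / p0 p = ∫ y, F (Real.sinh (y + a)) := by
  rw [integral_add_right_eq_self (fun y => F (Real.sinh y)) a, ← setIntegral_univ,
    ← Real.sinh_surjective.range_eq, ← Set.image_univ,
    integral_image_eq_integral_abs_deriv_smul MeasurableSet.univ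
      (fun y _ => (Real.hasDerivAt_sinh y).hasDerivWithinAt) Real.sinh_injective.injOn,
    setIntegral_univ]
  refine integral_congr_ae (Filter.Eventually.of_forall fun y => ?_)
  have := Real.cosh_pos y
  simp only [p0_sinh, abs_of_pos this, smul_eq_mul]
  field_simp

section boost

variable {u a : ℝ}

theorem energy_sinh (hc : Real.cosh a = U0 u) (hs : Real.sinh a = U1 u) (y : ℝ) :
    energy u (Real.sinh (y + a)) = Real.cosh y := by
  rw [energy, p0_sinh, ← hc, ← hs, ← Real.cosh_neg a, ← neg_neg (Real.sinh a), ← Real.sinh_neg]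
  have := Real.cosh_add (y + a) (-a)
  rw [add_neg_cancel_right] at this
  rw [this]
  ring

theorem pBracket_sinh (hc : Real.cosh a = U0 u) (hs : Real.sinh a = U1 u) (y : ℝ) :
    pBracket u (Real.sinh (y + a)) = -(U0 u * Real.sinh y) := by
  rw [pBracket, energy_sinh hc hs, ← hc, ← hs, Real.sinh_add]
  ring

theorem gEq_sinh (hc : Real.cosh a = U0 u) (hs : Real.sinh a = U1 u) (θ y : ℝ) :
    gEq u θ (Real.sinh (y + a)) = kern (1 / θ) y := by
  rw [gEq, kern, energy_sinh hc hs]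
  congr 2
  ring

theorem gInner_eq_rapInt (hc : Real.cosh a = U0 u) (hs : Real.sinh a = U1 u) {θ : ℝ} (hθ : 0 < θ)
    {f h F H : ℝ → ℝ} (hf : ∀ y, f (Real.sinh (y + a)) = kern (1 / θ) y * F y)
    (hh : ∀ y, h (Real.sinh (y + a)) = kern (1 / θ) y * H y) :
    gInner u θ f h = rapInt (1 / θ) fun y => F y * H y := by
  rw [gInner, integral_div_p0 (fun p => 1 / gEq u θ p * f p * h p) a, rapInt]
  refine integral_congr_ae (Filter.Eventually.of_forall fun y => ?_)
  have := kern_pos (one_div_pos.2 hθ) y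
  simp only [gEq_sinh hc hs, hf, hh]
  field_simp

end boost

/-! ### The basis in the rapidity variable -/

/-- The polynomial in `cosh` of the even part of a basis function. -/
def evenPart (ζ : ℝ) (i : ℕ) : ℝ[X] :=
  if i = 0 ∨ i % 2 = 1 then orthoPoly 0 ζ ((i + 1) / 2) else 0

/-- The polynomial in `cosh` multiplying `-sinh` in the odd part of a basis function. -/
def oddPart (ζ : ℝ) (i : ℕ) : ℝ[X] :=
  if i = 0 ∨ i % 2 = 1 then 0 else orthoPoly 1 ζ (i / 2 - 1)

/-- The basis functions in the rapidity variable, without the factor `kern`. -/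
def rapBasis (ζ : ℝ) (i : ℕ) (y : ℝ) : ℝ :=
  (evenPart ζ i).eval (Real.cosh y) - (oddPart ζ i).eval (Real.cosh y) * Real.sinh y

theorem coshGrowth_rapBasis (ζ : ℝ) (i : ℕ) : CoshGrowth (rapBasis ζ i) :=
  (CoshGrowth.cosh.eval _).sub ((CoshGrowth.cosh.eval _).mul CoshGrowth.sinh)

theorem basisFn_sinh {u a : ℝ} (hu : |u| < 1) (hc : Real.cosh a = U0 u) (hs : Real.sinh a = U1 u)
    (θ : ℝ) (i : ℕ) (y : ℝ) :
    basisFn i u θ (Real.sinh (y + a)) = kern (1 / θ) y * rapBasis (1 / θ) i y := by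
  have hU := (U0_pos hu).ne'
  unfold basisFn rapBasis evenPart oddPart
  by_cases h0 : i = 0
  · simp [h0, basis0, gEq_sinh hc hs, energy_sinh hc hs]
  · by_cases h1 : i % 2 = 1
    · simp [h0, h1, basis0, gEq_sinh hc hs, energy_sinh hc hs]
    · simp only [h0, h1, basis1, gEq_sinh hc hs, energy_sinh hc hs, pBracket_sinh hc hs,
        or_self, if_false, Polynomial.eval_zero]
      field_simp
      ring

/-- The even-odd cross terms are odd in `y` and integrate to zero; in the odd-odd term `sinh²`
supplies the weight for `ℓ = 1`. -/
theorem rapInt_mul_rapBasis {ζ : ℝ} (hζ : 0 < ζ) (m : ℝ[X]) (i j : ℕ) :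
    rapInt ζ (fun y => m.eval (Real.cosh y) * rapBasis ζ i y * rapBasis ζ j y) =
      polyInner 0 ζ (m * evenPart ζ i) (evenPart ζ j) +
        polyInner 1 ζ (m * oddPart ζ i) (oddPart ζ j) := by
  set e := evenPart ζ
  set o := oddPart ζ
  have hcross : CoshGrowth fun y =>
      -(m.eval (Real.cosh y) * ((e i).eval (Real.cosh y) * (o j).eval (Real.cosh y) +
        (o i).eval (Real.cosh y) * (e j).eval (Real.cosh y)) * Real.sinh y) :=
    ((((CoshGrowth.cosh.eval m).mul (((CoshGrowth.cosh.eval _).mul (CoshGrowth.cosh.eval _)).add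
      ((CoshGrowth.cosh.eval _).mul (CoshGrowth.cosh.eval _))))).mul CoshGrowth.sinh).neg
  have hodd := rapInt_eq_zero_of_odd ζ (F := fun y =>
      -(m.eval (Real.cosh y) * ((e i).eval (Real.cosh y) * (o j).eval (Real.cosh y) +
        (o i).eval (Real.cosh y) * (e j).eval (Real.cosh y)) * Real.sinh y))
      (fun y => by simp)
  rw [polyInner_eq_rapInt, polyInner_eq_rapInt,
    ← rapInt_add hζ (coshGrowth_polyInner 0 _ _) (coshGrowth_polyInner 1 _ _),
    ← add_zero (rapInt ζ fun y => _ + _), ← hodd,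
    ← rapInt_add hζ ((coshGrowth_polyInner 0 _ _).add (coshGrowth_polyInner 1 _ _)) hcross]
  congr 1
  funext y
  simp only [Polynomial.eval_mul, rapBasis, e, o]
  ring

theorem rapInt_rapBasis {ζ : ℝ} (hζ : 0 < ζ) (i j : ℕ) :
    rapInt ζ (fun y => rapBasis ζ i y * rapBasis ζ j y) = if i = j then 1 else 0 := by
  have h := rapInt_mul_rapBasis hζ 1 i j
  simp only [Polynomial.eval_one, one_mul] at h
  have hz : ∀ ℓ (f : ℝ[X]), polyInner ℓ ζ 0 f = 0 := fun ℓ f => by simp [polyInner]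
  rw [h, evenPart, evenPart, oddPart, oddPart]
  split_ifs <;>
    simp only [hz, polyInner_comm _ _ _ 0, polyInner_orthoPoly _ hζ, add_zero, zero_add] <;>
    (try split_ifs) <;> first | rfl | (exfalso; omega)

/-! ### Derivatives of the local equilibrium -/

/-- Rests on `∂E/∂u = U⁰ p_{<1>}`, so varying `u` produces a multiple of `P̃⁽¹⁾_0`. -/
theorem hasDerivAt_gEq_left {u : ℝ} (hu : |u| < 1) (θ p : ℝ) :
    HasDerivAt (fun s => gEq s θ p) (-(U0 u / θ) * (gEq u θ p * pBracket u p)) u := by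
  have h := one_sub_sq_pos hu
  have hr : 0 < √(1 - u ^ 2) := Real.sqrt_pos.2 h
  have hsq : √(1 - u ^ 2) ^ 2 = 1 - u ^ 2 := Real.sq_sqrt h.le
  have hd : HasDerivAt (fun s : ℝ => √(1 - s ^ 2)) (-u / √(1 - u ^ 2)) u := by
    have := (((hasDerivAt_id u).pow 2).const_sub 1).sqrt h.ne'
    refine this.congr_deriv ?_
    simp only [id, Pi.pow_apply]
    push_cast
    field_simp
  have hE : HasDerivAt (fun s => energy s p) (U0 u * pBracket u p) u := by
    have := ((((hasDerivAt_const u (1 : ℝ)).div hd hr.ne').mul_const (p0 p)).sub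
      (((hasDerivAt_id u).div hd hr.ne').mul_const p))
    refine this.congr_deriv ?_
    simp only [pBracket, energy, U0, U1, id]
    rw [hsq]
    field_simp
    simp only [hsq]
    ring
  have := ((hE.div_const θ).neg.exp).const_mul (1 / (2 * besselK 1 (1 / θ)))
  refine this.congr_deriv ?_
  simp only [gEq, Pi.neg_apply]
  ring

/-- Here `κ` is the logarithmic derivative of the normalization. Only the nonzero slope in `E` of
the factor is used later. -/
theorem exists_hasDerivAt_gEq_right (u : ℝ) {θ : ℝ} (hθ : 0 < θ) :
    ∃ κ : ℝ, ∀ p, HasDerivAt (fun s => gEq u s p)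
      (gEq u θ p * (energy u p / θ ^ 2 + κ)) θ := by
  have hK := besselK_one_pos (one_div_pos.2 hθ)
  have hdiff : DifferentiableAt ℝ (fun s => 1 / (2 * besselK 1 (1 / s))) θ := by
    have h1 : DifferentiableAt ℝ (fun s : ℝ => 1 / s) θ :=
      (differentiableAt_const 1).div differentiableAt_id hθ.ne'
    have h2 := (differentiableAt_besselK_one (one_div_pos.2 hθ)).comp θ h1
    exact (differentiableAt_const 1).div (h2.const_mul 2) (by simpa using hK.ne')
  refine ⟨deriv (fun s => 1 / (2 * besselK 1 (1 / s))) θ * (2 * besselK 1 (1 / θ)), fun p => ?_⟩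
  have hexp := (((hasDerivAt_const θ (energy u p)).div (hasDerivAt_id θ) hθ.ne').neg).exp
  refine (hdiff.hasDerivAt.mul hexp).congr_deriv ?_
  simp only [gEq, id, Pi.div_apply, Pi.neg_apply]
  field_simp
  ring

/-! ### The coefficient matrix and the ansatz -/

variable {M : ℕ}

/-- Numerals in `Fin (2 * M + 1)` are reduced modulo `2 * M + 1`, so `M ≥ 1` matters. -/
theorem fin_val_one (hM : 1 ≤ M) : ((1 : Fin (2 * M + 1)) : ℕ) = 1 :=
  Nat.mod_eq_of_lt (show 1 < 2 * M + 1 by omega)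

theorem fin_val_two (hM : 1 ≤ M) : ((2 : Fin (2 * M + 1)) : ℕ) = 2 :=
  Nat.mod_eq_of_lt (show 2 < 2 * M + 1 by omega)

theorem equilibrium_zero (ρ u θ : ℝ) : equilibrium M ρ u θ 0 = ρ := rfl

theorem equilibrium_one (hM : 1 ≤ M) (ρ u θ : ℝ) : equilibrium M ρ u θ 1 = u := by
  simp only [equilibrium, fin_val_one hM]

theorem equilibrium_two (hM : 1 ≤ M) (ρ u θ : ℝ) : equilibrium M ρ u θ 2 = θ := by
  simp only [equilibrium, fin_val_two hM]

theorem update_equilibrium_zero (ρ u θ s : ℝ) :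
    Function.update (equilibrium M ρ u θ) 0 s = equilibrium M s u θ := by
  funext i
  by_cases h : i = 0
  · simp [h, equilibrium_zero]
  · have : (i : ℕ) ≠ 0 := fun h' => h (Fin.ext h')
    rw [Function.update_of_ne h]
    simp only [equilibrium]
    split <;> first | rfl | omega

theorem update_equilibrium_one (hM : 1 ≤ M) (ρ u θ s : ℝ) :
    Function.update (equilibrium M ρ u θ) 1 s = equilibrium M ρ s θ := by
  funext i
  by_cases h : i = 1
  · simp [h, equilibrium_one hM]
  · have : (i : ℕ) ≠ 1 := fun h' => h (Fin.ext (h'.trans (fin_val_one hM).symm))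
    rw [Function.update_of_ne h]
    simp only [equilibrium]
    split <;> first | rfl | omega

theorem update_equilibrium_two (hM : 1 ≤ M) (ρ u θ s : ℝ) :
    Function.update (equilibrium M ρ u θ) 2 s = equilibrium M ρ u s := by
  funext i
  by_cases h : i = 2
  · simp [h, equilibrium_two hM]
  · have : (i : ℕ) ≠ 2 := fun h' => h (Fin.ext (h'.trans (fin_val_two hM).symm))
    rw [Function.update_of_ne h]
    simp only [equilibrium]
    split <;> first | rfl | omega

theorem coeffMatrix_zero_zero (θ : ℝ) :
    coeffMatrix M θ 0 0 = (orthoScale 0 (1 / θ) 0)⁻¹ := by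
  simp [coeffMatrix, orthoPoly_zero]

theorem coeffMatrix_eq_zero {θ : ℝ} {i j : Fin (2 * M + 1)} (hj : (j : ℕ) < 3)
    (h : (i : ℕ) ≠ 0 ∨ (j : ℕ) ≠ 0) : coeffMatrix M θ i j = 0 := by
  simp only [coeffMatrix, Matrix.of_apply]
  split <;> first | omega | (rw [if_neg]; omega)

theorem basisFn_zero (θ u p : ℝ) :
    basisFn 0 u θ p = gEq u θ p * orthoScale 0 (1 / θ) 0 := by
  simp [basisFn, basis0, orthoPoly_zero]

/-- Only the upper left entry acts, and it cancels the constant `P⁽⁰⁾_0`. Varying `ρ`, `u` or `θ`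
thus stays among equilibria, and the orthogonal polynomials never have to be differentiated in `θ`.
-/
theorem ansatz_equilibrium {ρ u θ : ℝ} (hM : 1 ≤ M) (hθ : 0 < θ) (p : ℝ) :
    ansatz M (equilibrium M ρ u θ) p = ρ * gEq u θ p := by
  have hc := (orthoScale_pos 0 (one_div_pos.2 hθ) 0).ne'
  have hmul : ∀ i : Fin (2 * M + 1), (coeffMatrix M θ).mulVec (equilibrium M ρ u θ) i =
      coeffMatrix M θ i 0 * ρ := fun i => by
    rw [Matrix.mulVec, dotProduct, Finset.sum_eq_single 0 (fun j _ hj => ?_) (by simp),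
      equilibrium_zero]
    have hj0 : (j : ℕ) ≠ 0 := fun h' => hj (Fin.ext h')
    by_cases h3 : (j : ℕ) < 3
    · rw [coeffMatrix_eq_zero h3 (Or.inr hj0), zero_mul]
    · have : equilibrium M ρ u θ j = 0 := by
        simp only [equilibrium]
        split <;> first | rfl | omega
      rw [this, mul_zero]
  simp only [ansatz, equilibrium_one hM, equilibrium_two hM, hmul]
  rw [Finset.sum_eq_single 0 (fun i _ hi => ?_) (by simp)]
  · rw [coeffMatrix_zero_zero, Fin.val_zero, basisFn_zero]
    field_simp
  · rw [coeffMatrix_eq_zero (by simp) (Or.inl fun h' => hi (Fin.ext h'))]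
    ring

theorem deriv_ansatz_of_ne {j : Fin (2 * M + 1)} (h1 : j ≠ 1) (h2 : j ≠ 2)
    (W : Fin (2 * M + 1) → ℝ) (p : ℝ) :
    deriv (fun s => ansatz M (Function.update W j s) p) (W j) =
      ∑ i : Fin (2 * M + 1), coeffMatrix M (W 2) i j * basisFn i (W 1) (W 2) p := by
  have hup : ∀ s, Function.update W j s = W + (s - W j) • Pi.single j 1 := fun s => by
    funext i
    by_cases h : i = j
    · subst h; simp
    · simp [h]
  -- The coefficient matrix and the basis depend only on `W 1` and `W 2`, so the ansatz is affine in
  -- every other component.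
  have key : (fun s => ansatz M (Function.update W j s) p) = fun s => ansatz M W p + (s - W j) *
      ∑ i : Fin (2 * M + 1), coeffMatrix M (W 2) i j * basisFn i (W 1) (W 2) p := by
    funext s
    simp only [ansatz, Function.update_of_ne h1.symm, Function.update_of_ne h2.symm]
    rw [hup, Finset.mul_sum, ← Finset.sum_add_distrib]
    refine Finset.sum_congr rfl fun i _ => ?_
    rw [Matrix.mulVec_add, Matrix.mulVec_smul, Matrix.mulVec_single_one]
    simp only [Pi.add_apply, Pi.smul_apply, smul_eq_mul, Matrix.col_apply]
    ring
  rw [key]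
  exact ((((hasDerivAt_id (W j)).sub_const (W j)).mul_const _).const_add _).deriv.trans
    (one_mul _)

/-! ### The matrix `D_M` at local equilibrium -/

/-- By orthonormality, projecting a function already in the span returns its coefficients. -/
theorem matD_eq_of_deriv {W : Fin (2 * M + 1) → ℝ} (hu : |W 1| < 1) (hθ : 0 < W 2)
    (D : Matrix (Fin (2 * M + 1)) (Fin (2 * M + 1)) ℝ)
    (h : ∀ j p, deriv (fun s => ansatz M (Function.update W j s) p) (W j) =
      ∑ k, D k j * basisFn k (W 1) (W 2) p) : matD M W = D := by
  have hζ := one_div_pos.2 hθ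
  obtain ⟨a, hc, hs⟩ := exists_rapidity hu
  ext i j
  simp only [matD, Matrix.of_apply]
  rw [gInner_eq_rapInt hc hs hθ (F := fun y => ∑ k, D k j * rapBasis (1 / W 2) k y)
    (fun y => ?_) (basisFn_sinh hu hc hs _ i)]
  · simp only [Finset.sum_mul]
    rw [rapInt_sum hζ _ fun k _ => ((CoshGrowth.const (D k j)).mul (coshGrowth_rapBasis _ k)).mul
      (coshGrowth_rapBasis _ i)]
    simp only [mul_assoc, rapInt_const_mul, rapInt_rapBasis hζ]
    rw [Finset.sum_eq_single i (fun k _ hk => ?_) (by simp)]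
    · simp
    · rw [if_neg (fun h' => hk (Fin.ext h')), mul_zero]
  · rw [h, Finset.mul_sum]
    refine Finset.sum_congr rfl fun k _ => ?_
    rw [basisFn_sinh hu hc hs]
    ring

/-- The part of `D_M` at local equilibrium that stems from the derivatives with respect to
`ρ`, `u` and `θ`. -/
def fluidBlock (M : ℕ) (r₀ r₁ α β : ℝ) : Matrix (Fin (2 * M + 1)) (Fin (2 * M + 1)) ℝ :=
  Matrix.of fun i j =>
    match (i : ℕ), (j : ℕ) with
    | 0, 0 => r₀
    | 2, 1 => r₁
    | 0, 2 => α
    | 1, 2 => β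
    | _, _ => 0

theorem fluidBlock_eq_zero_of_row {r₀ r₁ α β : ℝ} {i j : Fin (2 * M + 1)} (hi : 3 ≤ (i : ℕ)) :
    fluidBlock M r₀ r₁ α β i j = 0 := by
  simp only [fluidBlock, Matrix.of_apply]
  split <;> first | rfl | omega

theorem fluidBlock_eq_zero_of_col {r₀ r₁ α β : ℝ} {i j : Fin (2 * M + 1)} (hj : 3 ≤ (j : ℕ)) :
    fluidBlock M r₀ r₁ α β i j = 0 := by
  simp only [fluidBlock, Matrix.of_apply]
  split <;> first | rfl | omega

theorem coeffMatrixTilde_eq_zero {θ : ℝ} {i j : Fin (2 * M + 1)} (hj : (j : ℕ) < 3) :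
    coeffMatrixTilde M θ i j = 0 := by
  simp only [coeffMatrixTilde, Matrix.of_apply]
  split_ifs with h
  · rfl
  · exact coeffMatrix_eq_zero hj (by omega)

theorem coeffMatrixTilde_eq {θ : ℝ} {i j : Fin (2 * M + 1)} (hj : 3 ≤ (j : ℕ)) :
    coeffMatrixTilde M θ i j = coeffMatrix M θ i j := by
  simp only [coeffMatrixTilde, Matrix.of_apply]
  rw [if_neg (by omega)]

theorem exists_matD_equilibrium (hM : 1 ≤ M) {ρ u θ : ℝ} (hρ : 0 < ρ) (hu : |u| < 1)
    (hθ : 0 < θ) : ∃ r₀ r₁ α β : ℝ, r₀ ≠ 0 ∧ r₁ ≠ 0 ∧ β ≠ 0 ∧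
      matD M (equilibrium M ρ u θ) = coeffMatrixTilde M θ + fluidBlock M r₀ r₁ α β := by
  have hζ := one_div_pos.2 hθ
  have hc0 := (orthoScale_pos 0 hζ 0).ne'
  have hc1 := (orthoScale_pos 1 hζ 0).ne'
  have hU := (U0_pos hu).ne'
  obtain ⟨κ, hκ⟩ := exists_hasDerivAt_gEq_right u hθ
  set q : ℝ[X] := Polynomial.C (1 / θ ^ 2) * Polynomial.X + Polynomial.C κ with hq
  have hqdeg : q.natDegree = 1 := Polynomial.natDegree_linear (by positivity)
  have hqexp := eq_sum_orthoPoly 0 hζ (n := 2) (f := q)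
    (Polynomial.degree_le_natDegree.trans_lt (by rw [hqdeg]; exact Nat.cast_lt.2 one_lt_two))
  simp only [Finset.sum_range_succ, Finset.sum_range_zero, zero_add] at hqexp
  set α := polyInner 0 (1 / θ) q (orthoPoly 0 (1 / θ) 0)
  set β := polyInner 0 (1 / θ) q (orthoPoly 0 (1 / θ) 1)
  -- Otherwise the degree-one polynomial `q` would be constant.
  have hβ : β ≠ 0 := by
    intro h
    rw [h, zero_smul, add_zero, orthoPoly_zero, Polynomial.smul_C] at hqexp
    rw [hqexp, Polynomial.natDegree_C] at hqdeg
    exact absurd hqdeg (by norm_num)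
  refine ⟨(orthoScale 0 (1 / θ) 0)⁻¹, -(ρ / θ) * U0 u ^ 2 * (orthoScale 1 (1 / θ) 0)⁻¹,
    ρ * α, ρ * β, inv_ne_zero hc0, ?_, mul_ne_zero hρ.ne' hβ, ?_⟩
  · have := U0_pos hu
    exact mul_ne_zero (mul_ne_zero (neg_ne_zero.2 (by positivity)) (by positivity))
      (inv_ne_zero hc1)
  apply matD_eq_of_deriv
  · rwa [equilibrium_one hM]
  · rwa [equilibrium_two hM]
  intro j p
  rw [equilibrium_one hM, equilibrium_two hM]
  have hcases : j = 0 ∨ j = 1 ∨ j = 2 ∨ 3 ≤ (j : ℕ) := by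
    simp only [Fin.ext_iff, fin_val_one hM, fin_val_two hM, Fin.val_zero]
    omega
  rcases hcases with rfl | rfl | rfl | hj
  · simp only [update_equilibrium_zero, ansatz_equilibrium hM hθ, equilibrium_zero]
    rw [((hasDerivAt_id' ρ).mul_const _).deriv, Finset.sum_eq_single 0 (fun i _ hi => ?_) (by simp)]
    · simp only [Matrix.add_apply, coeffMatrixTilde_eq_zero (j := (0 : Fin (2 * M + 1))) (by simp),
        fluidBlock, Matrix.of_apply, Fin.val_zero, basisFn_zero]
      field_simp
      ring
    · have : (i : ℕ) ≠ 0 := fun h' => hi (Fin.ext h')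
      rw [Matrix.add_apply, coeffMatrixTilde_eq_zero (by simp), fluidBlock, Matrix.of_apply,
        Fin.val_zero]
      split <;> first | omega | simp
  · simp only [update_equilibrium_one hM, ansatz_equilibrium hM hθ, equilibrium_one hM]
    rw [((hasDerivAt_gEq_left hu θ p).const_mul ρ).deriv,
      Finset.sum_eq_single 2 (fun i _ hi => ?_) (by simp)]
    · simp only [Matrix.add_apply, coeffMatrixTilde_eq_zero (j := (1 : Fin (2 * M + 1)))
        (by rw [fin_val_one hM]; norm_num), fluidBlock, Matrix.of_apply, fin_val_one hM,
        fin_val_two hM, basisFn, basis1]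
      simp [orthoPoly_zero]
      field_simp
    · have : (i : ℕ) ≠ 2 := fun h' => hi (Fin.ext (h'.trans (fin_val_two hM).symm))
      rw [Matrix.add_apply, coeffMatrixTilde_eq_zero (by rw [fin_val_one hM]; norm_num),
        fluidBlock, Matrix.of_apply, fin_val_one hM]
      split <;> first | omega | simp
  · have hder : deriv (fun s => ansatz M (Function.update (equilibrium M ρ u θ) 2 s) p) θ =
        ρ * (gEq u θ p * q.eval (energy u p)) := by
      refine HasDerivAt.deriv ?_
      have := (hκ p).const_mul ρ
      have hqe : q.eval (energy u p) = energy u p / θ ^ 2 + κ := by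
        simp only [hq, Polynomial.eval_add, Polynomial.eval_mul, Polynomial.eval_C,
          Polynomial.eval_X]
        ring
      rw [hqe]
      -- The ansatz is known to be the equilibrium only for positive temperature, hence an equality
      -- near `θ`.
      refine this.congr_of_eventuallyEq ?_
      filter_upwards [Ioi_mem_nhds hθ] with s hs
      rw [update_equilibrium_two hM, ansatz_equilibrium hM hs]
    have h01 : (0 : Fin (2 * M + 1)) ≠ 1 := fun h => by
      have := congrArg Fin.val h
      rw [fin_val_one hM] at this
      simp at this
    rw [equilibrium_two hM, hder, Finset.sum_eq_add 0 1 h01 (fun i _ hi => ?_) (by simp) (by simp)]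
    · conv_lhs => rw [hqexp]
      simp only [Matrix.add_apply, coeffMatrixTilde_eq_zero (j := (2 : Fin (2 * M + 1)))
        (by rw [fin_val_two hM]; norm_num), fluidBlock, Matrix.of_apply, fin_val_one hM,
        fin_val_two hM, basisFn, basis0, Fin.val_zero]
      simp
      ring
    · have hi0 : (i : ℕ) ≠ 0 := fun h' => hi.1 (Fin.ext h')
      have hi1 : (i : ℕ) ≠ 1 := fun h' => hi.2 (Fin.ext (h'.trans (fin_val_one hM).symm))
      rw [Matrix.add_apply, coeffMatrixTilde_eq_zero (by rw [fin_val_two hM]; norm_num),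
        fluidBlock, Matrix.of_apply, fin_val_two hM]
      split <;> first | omega | simp
  · have h1 : j ≠ 1 := fun h => by rw [h, fin_val_one hM] at hj; omega
    have h2 : j ≠ 2 := fun h => by rw [h, fin_val_two hM] at hj; omega
    rw [deriv_ansatz_of_ne h1 h2, equilibrium_one hM, equilibrium_two hM]
    refine Finset.sum_congr rfl fun k _ => ?_
    rw [Matrix.add_apply, coeffMatrixTilde_eq hj, fluidBlock_eq_zero_of_col hj, add_zero]

/-- `D_M` at local equilibrium is injective. -/
theorem eq_zero_of_mulVec_eq_zero (hM : 1 ≤ M) {r₀ r₁ α β θ : ℝ} (h0 : r₀ ≠ 0) (h1 : r₁ ≠ 0)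
    (hβ : β ≠ 0) (hθ : 0 < θ) {w : Fin (2 * M + 1) → ℂ}
    (hw : ((coeffMatrixTilde M θ + fluidBlock M r₀ r₁ α β).map Complex.ofReal).mulVec w = 0) :
    w = 0 := by
  have hζ := one_div_pos.2 hθ
  set D := coeffMatrixTilde M θ + fluidBlock M r₀ r₁ α β with hD
  have hrow : ∀ i k : Fin (2 * M + 1), (∀ j, j ≠ k → D i j = 0 ∨ w j = 0) → D i k ≠ 0 →
      w k = 0 := fun i k hz hk => by
    have h := congrFun hw i
    simp only [Matrix.mulVec, dotProduct, Matrix.map_apply, Pi.zero_apply] at h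
    rw [Finset.sum_eq_single k (fun j _ hj => by rcases hz j hj with h | h <;> simp [h])
      (by simp)] at h
    exact (mul_eq_zero.1 h).resolve_left (Complex.ofReal_ne_zero.2 hk)
  -- Rows from `3` on are diagonal with nonzero entries. Once these components vanish, row `2`
  -- isolates `w 1`, row `1` isolates `w 2`, and row `0` then isolates `w 0`.
  have htail : ∀ i : Fin (2 * M + 1), 3 ≤ (i : ℕ) → w i = 0 := fun i hi => by
    refine hrow i i (fun j hj => Or.inl ?_) ?_
    · have hij : (j : ℕ) ≠ i := fun h => hj (Fin.ext h)
      rw [hD, Matrix.add_apply, fluidBlock_eq_zero_of_row hi, add_zero]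
      by_cases hj3 : (j : ℕ) < 3
      · exact coeffMatrixTilde_eq_zero hj3
      · rw [coeffMatrixTilde_eq (by omega)]
        simp only [coeffMatrix, Matrix.of_apply]
        split <;> first | omega | (rw [if_neg]; omega)
    · rw [hD, Matrix.add_apply, fluidBlock_eq_zero_of_row hi, add_zero, coeffMatrixTilde_eq hi]
      obtain h3 | h4 | h5 : (i : ℕ) = 3 ∨ (i : ℕ) = 4 ∨ 5 ≤ (i : ℕ) := by omega
      · simp only [coeffMatrix, Matrix.of_apply, h3]
        exact neg_ne_zero.2 (orthoPoly_eval_zero_ne 0 hζ 2)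
      · simp only [coeffMatrix, Matrix.of_apply, h4]
        exact neg_ne_zero.2 (orthoPoly_eval_zero_ne 1 hζ 1)
      · simp only [coeffMatrix, Matrix.of_apply]
        split <;> first | omega | (rw [if_pos ⟨rfl, h5⟩]; exact one_ne_zero)
  have hval : ∀ i j : Fin (2 * M + 1), (j : ℕ) < 3 → D i j = fluidBlock M r₀ r₁ α β i j :=
    fun i j hj => by rw [hD, Matrix.add_apply, coeffMatrixTilde_eq_zero hj, zero_add]
  have hv1 := fin_val_one hM
  have hv2 := fin_val_two hM
  have w1 : w 1 = 0 := by
    refine hrow 2 1 (fun j hj => ?_) ?_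
    · have hj1 : (j : ℕ) ≠ 1 := fun h => hj (Fin.ext (h.trans hv1.symm))
      by_cases hj3 : (j : ℕ) < 3
      · left
        rw [hval _ _ hj3, fluidBlock, Matrix.of_apply, hv2]
        split <;> first | rfl | omega
      · exact Or.inr (htail j (by omega))
    · rw [hval _ _ (by omega), fluidBlock, Matrix.of_apply, hv1, hv2]
      exact h1
  have w2 : w 2 = 0 := by
    refine hrow 1 2 (fun j hj => ?_) ?_
    · have hj1 : (j : ℕ) ≠ 2 := fun h => hj (Fin.ext (h.trans hv2.symm))
      by_cases hj3 : (j : ℕ) < 3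
      · left
        rw [hval _ _ hj3, fluidBlock, Matrix.of_apply, hv1]
        split <;> first | rfl | omega
      · exact Or.inr (htail j (by omega))
    · rw [hval _ _ (by omega), fluidBlock, Matrix.of_apply, hv1, hv2]
      exact hβ
  have w0 : w 0 = 0 := by
    refine hrow 0 0 (fun j hj => Or.inr ?_) ?_
    · have hj0 : (j : ℕ) ≠ 0 := fun h => hj (Fin.ext h)
      by_cases hj3 : (j : ℕ) < 3
      · obtain h | h : (j : ℕ) = 1 ∨ (j : ℕ) = 2 := by omega
        · rwa [show j = 1 from Fin.ext (h.trans hv1.symm)]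
        · rwa [show j = 2 from Fin.ext (h.trans hv2.symm)]
      · exact htail j (by omega)
    · rw [hval _ _ (by simp), fluidBlock, Matrix.of_apply]
      exact h0
  funext j
  by_cases hj3 : (j : ℕ) < 3
  · obtain h | h | h : (j : ℕ) = 0 ∨ (j : ℕ) = 1 ∨ (j : ℕ) = 2 := by omega
    · rwa [show j = 0 from Fin.ext h]
    · rwa [show j = 1 from Fin.ext (h.trans hv1.symm)]
    · rwa [show j = 2 from Fin.ext (h.trans hv2.symm)]
  · exact htail j (by omega)

/-! ### The multiplication matrices -/

/-- The Gram matrix of the basis with respect to a weight `m` in the rapidity variable. -/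
def gram (M : ℕ) (ζ : ℝ) (m : ℝ → ℝ) : Matrix (Fin (2 * M + 1)) (Fin (2 * M + 1)) ℝ :=
  Matrix.of fun i j => rapInt ζ fun y => m y * rapBasis ζ i y * rapBasis ζ j y

theorem gram_isSymm (ζ : ℝ) (m : ℝ → ℝ) : (gram M ζ m).IsSymm := by
  ext i j
  simp only [gram, Matrix.transpose_apply, Matrix.of_apply, mul_assoc]
  simp only [mul_comm (rapBasis ζ j _)]

theorem matMt_eq_gram {u a θ : ℝ} (hu : |u| < 1) (hc : Real.cosh a = U0 u)
    (hs : Real.sinh a = U1 u) (hθ : 0 < θ) :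
    matMt M u θ = gram M (1 / θ) fun y => Real.cosh (y + a) := by
  ext i j
  rw [← (gram_isSymm _ _).apply]
  exact gInner_eq_rapInt hc hs hθ
    (fun y => by rw [p0_sinh, basisFn_sinh hu hc hs]; ring) (basisFn_sinh hu hc hs _ i)

theorem matMx_eq_gram {u a θ : ℝ} (hu : |u| < 1) (hc : Real.cosh a = U0 u)
    (hs : Real.sinh a = U1 u) (hθ : 0 < θ) :
    matMx M u θ = gram M (1 / θ) fun y => Real.sinh (y + a) := by
  ext i j
  rw [← (gram_isSymm _ _).apply]
  exact gInner_eq_rapInt hc hs hθ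
    (fun y => by rw [basisFn_sinh hu hc hs]; ring) (basisFn_sinh hu hc hs _ i)

theorem coshGrowth_cosh_add (a : ℝ) : CoshGrowth fun y => Real.cosh (y + a) := by
  simp only [Real.cosh_add]
  exact (CoshGrowth.cosh.mul (CoshGrowth.const _)).add (CoshGrowth.sinh.mul (CoshGrowth.const _))

theorem coshGrowth_sinh_add (a : ℝ) : CoshGrowth fun y => Real.sinh (y + a) := by
  simp only [Real.sinh_add]
  exact (CoshGrowth.sinh.mul (CoshGrowth.const _)).add (CoshGrowth.cosh.mul (CoshGrowth.const _))

/-- This is `cosh y = cosh a cosh (y + a) - sinh a sinh (y + a)`, that is, `E = U⁰ p⁰ - U¹ p`. -/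
theorem energy_matrix_eq_gram {u θ : ℝ} (hu : |u| < 1) (hθ : 0 < θ) :
    U0 u • matMt M u θ - U1 u • matMx M u θ = gram M (1 / θ) Real.cosh := by
  obtain ⟨a, hc, hs⟩ := exists_rapidity hu
  rw [matMt_eq_gram hu hc hs hθ, matMx_eq_gram hu hc hs hθ, ← hc, ← hs]
  ext i j
  simp only [gram, Matrix.sub_apply, Matrix.smul_apply, Matrix.of_apply, smul_eq_mul]
  rw [sub_eq_add_neg, ← neg_mul, ← rapInt_const_mul, ← rapInt_const_mul,
    ← rapInt_add (one_div_pos.2 hθ)]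
  · congr 1
    funext y
    have := Real.cosh_add (y + a) (-a)
    rw [add_neg_cancel_right, Real.cosh_neg, Real.sinh_neg] at this
    rw [this]
    ring
  · exact (CoshGrowth.const _).mul (((coshGrowth_cosh_add a).mul
      (coshGrowth_rapBasis _ _)).mul (coshGrowth_rapBasis _ _))
  · exact (CoshGrowth.const _).mul (((coshGrowth_sinh_add a).mul
      (coshGrowth_rapBasis _ _)).mul (coshGrowth_rapBasis _ _))

theorem dotProduct_gram_mulVec {ζ : ℝ} (hζ : 0 < ζ) {m : ℝ → ℝ} (hm : CoshGrowth m)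
    (x : Fin (2 * M + 1) → ℝ) : x ⬝ᵥ (gram M ζ m).mulVec x =
      rapInt ζ fun y => m y * (∑ i, x i * rapBasis ζ i y) ^ 2 := by
  have hexp : ∀ y, m y * (∑ i, x i * rapBasis ζ i y) ^ 2 =
      ∑ i, ∑ j, (x i * x j) * (m y * rapBasis ζ i y * rapBasis ζ j y) := fun y => by
    rw [pow_two, Finset.sum_mul_sum, Finset.mul_sum]
    refine Finset.sum_congr rfl fun i _ => ?_
    rw [Finset.mul_sum]
    refine Finset.sum_congr rfl fun j _ => ?_
    ring
  have hg : ∀ i j : Fin (2 * M + 1), CoshGrowth fun y =>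
      (x i * x j) * (m y * rapBasis ζ i y * rapBasis ζ j y) := fun i j =>
    (CoshGrowth.const _).mul ((hm.mul (coshGrowth_rapBasis ζ i)).mul (coshGrowth_rapBasis ζ j))
  simp only [hexp]
  rw [rapInt_sum hζ _ fun i _ => CoshGrowth.sum _ fun j _ => hg i j]
  refine Finset.sum_congr rfl fun i _ => ?_
  rw [rapInt_sum hζ _ fun j _ => hg i j, Matrix.mulVec, dotProduct, Finset.mul_sum]
  refine Finset.sum_congr rfl fun j _ => ?_
  rw [rapInt_const_mul, gram, Matrix.of_apply]
  ring

theorem gram_one {ζ : ℝ} (hζ : 0 < ζ) : gram M ζ (fun _ => 1) = 1 := by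
  ext i j
  simp only [gram, Matrix.of_apply, one_mul, rapInt_rapBasis hζ, Matrix.one_apply, Fin.ext_iff]

theorem coshGrowth_sum_sq (ζ : ℝ) (x : Fin (2 * M + 1) → ℝ) :
    CoshGrowth fun y => (∑ i, x i * rapBasis ζ i y) ^ 2 :=
  (CoshGrowth.sum _ fun i _ => (CoshGrowth.const (x i)).mul (coshGrowth_rapBasis ζ i)).pow 2

/-- The weight `1` gives the identity matrix, so a weight at least `1` gives coercivity. -/
theorem dotProduct_self_le_gram {ζ : ℝ} (hζ : 0 < ζ) {m : ℝ → ℝ} (hm : CoshGrowth m)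
    (h1 : ∀ y, 1 ≤ m y) (x : Fin (2 * M + 1) → ℝ) : x ⬝ᵥ x ≤ x ⬝ᵥ (gram M ζ m).mulVec x := by
  have h := dotProduct_gram_mulVec hζ (CoshGrowth.const 1) x
  rw [gram_one hζ, Matrix.one_mulVec] at h
  rw [h, dotProduct_gram_mulVec hζ hm]
  exact rapInt_mono hζ ((CoshGrowth.const 1).mul (coshGrowth_sum_sq ζ x))
    (hm.mul (coshGrowth_sum_sq ζ x))
    fun y => mul_le_mul_of_nonneg_right (h1 y) (sq_nonneg _)

/-! ### Orthogonality of the non-equilibrium part to the collision invariants -/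

theorem gram_cosh_apply {ζ : ℝ} (hζ : 0 < ζ) (i k : Fin (2 * M + 1)) :
    gram M ζ Real.cosh i k = polyInner 0 ζ (Polynomial.X * evenPart ζ i) (evenPart ζ k) +
      polyInner 1 ζ (Polynomial.X * oddPart ζ i) (oddPart ζ k) := by
  rw [← rapInt_mul_rapBasis hζ]
  simp [gram]

theorem polyInner_zero_right (ℓ : ℕ) (ζ : ℝ) (f : ℝ[X]) : polyInner ℓ ζ f 0 = 0 := by
  simp [polyInner]

theorem degree_X_mul_evenPart_lt {ζ : ℝ} {i : ℕ} (hi : i < 3) :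
    (Polynomial.X * evenPart ζ i).degree < ((3 : ℕ) : WithBot ℕ) := by
  rw [Polynomial.degree_lt_iff_coeff_zero]
  intro m hm
  refine Polynomial.coeff_eq_zero_of_natDegree_lt (lt_of_le_of_lt ?_ (show 2 < m by omega))
  refine Polynomial.natDegree_mul_le.trans ?_
  rw [Polynomial.natDegree_X]
  have : (evenPart ζ i).natDegree ≤ 1 := by
    rw [evenPart]
    split_ifs with h
    · exact (natDegree_orthoPoly_le 0 ζ _).trans (by omega)
    · simp
  omega

theorem degree_X_mul_oddPart_lt {ζ : ℝ} {i : ℕ} (hi : i < 3) :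
    (Polynomial.X * oddPart ζ i).degree < ((2 : ℕ) : WithBot ℕ) := by
  rw [Polynomial.degree_lt_iff_coeff_zero]
  intro m hm
  refine Polynomial.coeff_eq_zero_of_natDegree_lt (lt_of_le_of_lt ?_ (show 1 < m by omega))
  refine Polynomial.natDegree_mul_le.trans ?_
  rw [Polynomial.natDegree_X]
  have : (oddPart ζ i).natDegree ≤ 0 := by
    rw [oddPart]
    split_ifs with h
    · simp
    · exact (natDegree_orthoPoly_le 1 ζ _).trans (by omega)
  omega

/-- Conservation of mass, momentum and energy by the source. The columns for `Π` and `ñ¹` are minus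
reproducing kernels at `0`, so pairing them with `E` times one of the first three basis functions
evaluates a multiple of `X` at `0`. Later columns are single basis functions of degree too high to
pair nontrivially. -/
theorem gram_mul_coeffMatrixTilde {θ : ℝ} (hθ : 0 < θ) {i : Fin (2 * M + 1)} (hi : (i : ℕ) < 3)
    (l : Fin (2 * M + 1)) :
    (gram M (1 / θ) Real.cosh * coeffMatrixTilde M θ) i l = 0 := by
  have hζ := one_div_pos.2 hθ
  set ζ := 1 / θ with hζdef
  have hde := degree_X_mul_evenPart_lt (ζ := ζ) hi
  have hdo := degree_X_mul_oddPart_lt (ζ := ζ) hi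
  set e := Polynomial.X * evenPart ζ i with he
  set o := Polynomial.X * oddPart ζ i with ho
  have hA : ∀ k : Fin (2 * M + 1), gram M ζ Real.cosh i k =
      polyInner 0 ζ e (evenPart ζ k) + polyInner 1 ζ o (oddPart ζ k) :=
    fun k => gram_cosh_apply hζ i k
  rw [Matrix.mul_apply]
  by_cases hl : (l : ℕ) < 3
  · exact Finset.sum_eq_zero fun k _ => by rw [coeffMatrixTilde_eq_zero hl, mul_zero]
  have hl3 : 3 ≤ (l : ℕ) := by omega
  simp only [coeffMatrixTilde_eq hl3]
  obtain h3 | h4 | h5 : (l : ℕ) = 3 ∨ (l : ℕ) = 4 ∨ 5 ≤ (l : ℕ) := by omega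
  · have hrep := sum_polyInner_mul_eval 0 hζ hde 0
    have he0 : e.eval 0 = 0 := by simp [he]
    simp only [Finset.sum_range_succ, Finset.sum_range_zero, zero_add, he0] at hrep
    have hlt := l.isLt
    rw [Finset.sum_subset (Finset.subset_univ
      {(⟨0, by omega⟩ : Fin (2 * M + 1)), ⟨1, by omega⟩, ⟨3, by omega⟩}) (fun k _ hk => ?_) |>.symm]
    · rw [Finset.sum_insert (by simp), Finset.sum_insert (by simp), Finset.sum_singleton]
      simp only [hA, coeffMatrix, Matrix.of_apply, h3, evenPart, oddPart, ← hζdef]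
      norm_num [polyInner_zero_right]
      linarith
    · simp only [Finset.mem_insert, Finset.mem_singleton, Fin.ext_iff, not_or] at hk
      refine mul_eq_zero_of_right _ ?_
      simp only [coeffMatrix, Matrix.of_apply]
      split <;> first | omega | (rw [if_neg]; omega)
  -- The same with the degree-one kernel for `ℓ = 1`.
  · have hrep := sum_polyInner_mul_eval 1 hζ hdo 0
    have ho0 : o.eval 0 = 0 := by simp [ho]
    simp only [Finset.sum_range_succ, Finset.sum_range_zero, zero_add, ho0] at hrep
    have hlt := l.isLt
    rw [Finset.sum_subset (Finset.subset_univ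
      {(⟨2, by omega⟩ : Fin (2 * M + 1)), ⟨4, by omega⟩}) (fun k _ hk => ?_) |>.symm]
    · rw [Finset.sum_insert (by simp), Finset.sum_singleton]
      simp only [hA, coeffMatrix, Matrix.of_apply, h4, evenPart, oddPart, ← hζdef]
      norm_num [polyInner_zero_right]
      linarith
    · simp only [Finset.mem_insert, Finset.mem_singleton, Fin.ext_iff, not_or] at hk
      refine mul_eq_zero_of_right _ ?_
      simp only [coeffMatrix, Matrix.of_apply]
      split <;> first | omega | (rw [if_neg]; omega)
  · rw [Finset.sum_eq_single l (fun k _ hk => ?_) (by simp), hA]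
    · refine mul_eq_zero_of_left ?_ _
      rw [evenPart, oddPart]
      split_ifs with hodd
      · rw [polyInner_zero_right, add_zero]
        exact polyInner_orthoPoly_of_degree_lt 0 hζ
          (hde.trans_le (Nat.cast_le.2 (show 3 ≤ ((l : ℕ) + 1) / 2 by omega)))
      · rw [polyInner_zero_right, zero_add]
        exact polyInner_orthoPoly_of_degree_lt 1 hζ
          (hdo.trans_le (Nat.cast_le.2 (show 2 ≤ (l : ℕ) / 2 - 1 by omega)))
    · have hkl : (k : ℕ) ≠ l := fun h => hk (Fin.ext h)
      refine mul_eq_zero_of_right _ ?_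
      simp only [coeffMatrix, Matrix.of_apply]
      split <;> first | omega | (rw [if_neg]; omega)

theorem fluidBlock_transpose_mul {r₀ r₁ α β θ : ℝ} (hθ : 0 < θ) :
    (fluidBlock M r₀ r₁ α β).transpose *
      (gram M (1 / θ) Real.cosh * coeffMatrixTilde M θ) = 0 := by
  ext j l
  rw [Matrix.mul_apply]
  refine Finset.sum_eq_zero fun i _ => ?_
  by_cases hi : (i : ℕ) < 3
  · rw [gram_mul_coeffMatrixTilde hθ hi, mul_zero]
  · rw [Matrix.transpose_apply, fluidBlock_eq_zero_of_row (by omega), zero_mul]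

/-! ### Real symmetric matrices on complex vectors -/

/-- A real symmetric matrix has a real quadratic form on complex vectors. -/
theorem star_dotProduct_map_mulVec {n : Type*} [Fintype n] {S : Matrix n n ℝ} (hS : S.IsSymm)
    (v : n → ℂ) : star v ⬝ᵥ (S.map Complex.ofReal).mulVec v =
      (((fun i => (v i).re) ⬝ᵥ S.mulVec (fun i => (v i).re) +
        (fun i => (v i).im) ⬝ᵥ S.mulVec (fun i => (v i).im) : ℝ) : ℂ) := by
  have hsymm : ∑ i, ∑ j, (v i).re * (S i j * (v j).im) =
      ∑ i, ∑ j, (v i).im * (S i j * (v j).re) := by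
    rw [Finset.sum_comm]
    refine Finset.sum_congr rfl fun i _ => Finset.sum_congr rfl fun j _ => ?_
    rw [hS.apply]
    ring
  simp only [dotProduct, Matrix.mulVec, Finset.mul_sum]
  apply Complex.ext
  · simp [Complex.mul_re, Finset.sum_add_distrib]
  · simp only [Complex.im_sum, Complex.ofReal_im]
    simp [Complex.mul_im, Finset.sum_add_distrib, hsymm]

/-- The energy identity behind linear stability: a null vector of the dispersion matrix gives
real numbers `t > 0`, `x`, `s ≥ 0` with `iωt - ikx + s = 0`. -/
theorem DispersionRelation.exists_energy_identity (hM : 1 ≤ M) {τ : ℝ → ℝ → ℝ} {ρ u θ : ℝ}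
    (hρ : 0 < ρ) (hu : |u| < 1) (hθ : 0 < θ) (hτ : 0 < τ ρ θ) {ω k : ℂ}
    (h : DispersionRelation M τ (equilibrium M ρ u θ) ω k) :
    ∃ t x s : ℝ, 0 < t ∧ 0 ≤ s ∧ Complex.I * ω * t - Complex.I * k * x + s = 0 := by
  have hζ := one_div_pos.2 hθ
  obtain ⟨r₀, r₁, α, β, h0, h1, hβ, hD⟩ := exists_matD_equilibrium hM hρ hu hθ
  obtain ⟨a, hc, hs⟩ := exists_rapidity hu
  obtain ⟨w, hw0, hw⟩ := Matrix.exists_mulVec_eq_zero_iff.2 h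
  simp only [matB0, matB1, matQ, equilibrium_zero, equilibrium_one hM, equilibrium_two hM,
    energy_matrix_eq_gram hu hθ] at hw
  rw [matMt_eq_gram hu hc hs hθ, matMx_eq_gram hu hc hs hθ, hD] at hw
  set N := coeffMatrixTilde M θ with hN
  set R := fluidBlock M r₀ r₁ α β with hR
  set T := gram M (1 / θ) fun y => Real.cosh (y + a)
  set X := gram M (1 / θ) fun y => Real.sinh (y + a)
  set A := gram M (1 / θ) Real.cosh
  have hmap : ∀ P Q : Matrix (Fin (2 * M + 1)) (Fin (2 * M + 1)) ℝ,
      (P * Q).map Complex.ofReal = P.map Complex.ofReal * Q.map Complex.ofReal :=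
    fun P Q => Matrix.map_mul (f := Complex.ofRealHom)
  set v := ((N + R).map Complex.ofReal).mulVec w with hv
  set n := (N.map Complex.ofReal).mulVec w with hn
  have hv0 : v ≠ 0 := fun hv0 => hw0 (eq_zero_of_mulVec_eq_zero hM h0 h1 hβ hθ hv0)
  have hsmul : ((-(1 / τ ρ θ)) • (A * N)).map Complex.ofReal =
      ((-(1 / τ ρ θ) : ℝ) : ℂ) • (A.map Complex.ofReal * N.map Complex.ofReal) := by
    rw [← hmap]
    ext i j
    simp
  rw [hsmul, hmap, hmap, Matrix.sub_mulVec, Matrix.sub_mulVec, Matrix.smul_mulVec,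
    Matrix.smul_mulVec, Matrix.smul_mulVec, ← Matrix.mulVec_mulVec, ← Matrix.mulVec_mulVec,
    ← Matrix.mulVec_mulVec, ← hv, ← hn] at hw
  have hvn : v = n + (R.map Complex.ofReal).mulVec w := by
    rw [hv, Matrix.map_add _ (fun _ _ => Complex.ofReal_add _ _), Matrix.add_mulVec]
  -- The fluid part of `v` is orthogonal to `A n`, which makes the source term a nonnegative
  -- quadratic form in `n` alone.
  have horth : star v ⬝ᵥ (A.map Complex.ofReal).mulVec n =
      star n ⬝ᵥ (A.map Complex.ofReal).mulVec n := by
    have hzero : star ((R.map Complex.ofReal).mulVec w) ⬝ᵥ (A.map Complex.ofReal).mulVec n = 0 := by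
      have hRt : (R.map Complex.ofReal).conjTranspose = R.transpose.map Complex.ofReal := by
        ext i j
        simp
      rw [Matrix.star_mulVec, hRt, ← Matrix.dotProduct_mulVec, hn, Matrix.mulVec_mulVec,
        Matrix.mulVec_mulVec, ← hmap, ← hmap, Matrix.mul_assoc, fluidBlock_transpose_mul hθ]
      simp
    rw [hvn, star_add, add_dotProduct, hzero, add_zero]
  have hT : T.IsSymm := gram_isSymm _ _
  have hX : X.IsSymm := gram_isSymm _ _
  have hA : A.IsSymm := gram_isSymm _ _
  have key := congrArg (fun z => star v ⬝ᵥ z) hw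
  simp only [dotProduct_sub, dotProduct_smul, smul_eq_mul, dotProduct_zero, horth,
    star_dotProduct_map_mulVec hT, star_dotProduct_map_mulVec hX,
    star_dotProduct_map_mulVec hA] at key
  let q (S : Matrix (Fin (2 * M + 1)) (Fin (2 * M + 1)) ℝ) (z : Fin (2 * M + 1) → ℂ) : ℝ :=
    (fun i => (z i).re) ⬝ᵥ S.mulVec (fun i => (z i).re) +
      (fun i => (z i).im) ⬝ᵥ S.mulVec (fun i => (z i).im)
  refine ⟨q T v, q X v, 1 / τ ρ θ * q A n, ?_, ?_, ?_⟩
  · have hle := dotProduct_self_le_gram hζ (coshGrowth_cosh_add a)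
      (fun y => Real.one_le_cosh _) (M := M)
    refine lt_of_lt_of_le ?_ (add_le_add (hle fun i => (v i).re) (hle fun i => (v i).im))
    obtain ⟨i, hi⟩ := Function.ne_iff.1 hv0
    simp only [dotProduct, ← Finset.sum_add_distrib]
    refine Finset.sum_pos' (fun j _ => add_nonneg (mul_self_nonneg _) (mul_self_nonneg _))
      ⟨i, Finset.mem_univ i, ?_⟩
    rw [← Complex.normSq_apply]
    exact Complex.normSq_pos.2 hi
  · have hle := dotProduct_self_le_gram hζ CoshGrowth.cosh Real.one_le_cosh (M := M)
    have hnn : ∀ x : Fin (2 * M + 1) → ℝ, 0 ≤ x ⬝ᵥ x := fun x =>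
      Finset.sum_nonneg fun i _ => mul_self_nonneg (x i)
    exact mul_nonneg (by positivity)
      (add_nonneg ((hnn _).trans (hle _)) ((hnn _).trans (hle _)))
  · rw [← key]
    simp only [q]
    push_cast
    ring

end RelMoment

end

/-! ### Stability in time and in space from the energy identity. -/

theorem mainTheorem4 (M : ℕ) (hM : 1 ≤ M) (τ : ℝ → ℝ → ℝ) (ρ₀ u₀ θ₀ : ℝ)
    (hρ : 0 < ρ₀) (hu : |u₀| < 1) (hθ : 0 < θ₀) (hτ : 0 < τ ρ₀ θ₀) :
    (∀ (k : ℝ) (ω : ℂ),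
      RelMoment.DispersionRelation M τ (RelMoment.equilibrium M ρ₀ u₀ θ₀) ω (k : ℂ) →
        0 ≤ ω.im) ∧
    (∀ (ω : ℝ) (k : ℂ), 0 < ω →
      RelMoment.DispersionRelation M τ (RelMoment.equilibrium M ρ₀ u₀ θ₀) (ω : ℂ) k →
        k.re * k.im ≤ 0) := by
  refine ⟨fun k ω h => ?_, fun ω k hω h => ?_⟩
  · obtain ⟨t, x, s, ht, hs, key⟩ := h.exists_energy_identity hM hρ hu hθ hτ
    -- For real `k` the real part reads `Im ω · t = s`.
    have hre := congrArg Complex.re key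
    simp at hre
    by_contra! hneg
    nlinarith
  · obtain ⟨t, x, s, ht, hs, key⟩ := h.exists_energy_identity hM hρ hu hθ hτ
    have hre := congrArg Complex.re key
    have him := congrArg Complex.im key
    simp at hre him
    have h1 : k.im * x = -s := by linarith
    have h2 : k.re * x = ω * t := by linarith
    -- Since `Re k · x = ω t > 0`, `x` cannot vanish; multiplying by `x²` then fixes the sign of `Re
    -- k · Im k`.
    have hx : x ≠ 0 := by
      rintro rfl
      have := mul_pos hω ht
      simp at h2
      rcases h2 with h2 | h2 <;> linarith
    have h3 : (k.re * k.im) * x ^ 2 = -(ω * t * s) := by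
      calc _ = (k.re * x) * (k.im * x) := by ring
        _ = _ := by rw [h1, h2]; ring
    have h4 : 0 ≤ ω * t * s := by positivity
    by_contra! hneg
    have : 0 < (k.re * k.im) * x ^ 2 := by positivity
    linarith
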